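/- **Theorem (discrete a priori estimate II).** Let $d\ge 1$, let $\Omega\subset\mathbb R^d$ be a bounded open set (for example a bounded Lipschitz domain) and let $T>0$. Let $\phi:\mathbb R^d\to\mathbb R$ be an $\mathcal N$-function: $\phi$ is continuous, convex and even, $\phi(\xi)=0$ if and only if $\xi=0$, $\phi(\xi)/|\xi|\to\infty$ as $|\xi|\to\infty$ and $\phi(\xi)/|\xi|\to0$ as $|\xi|\to0$. Assume that $\phi$ is differentiable and that $\sigma=\nabla\phi:\mathbb R^d\to\mathbb R^d$ is continuous. Let $\phi^*(\eta)=\sup_{\xi}(\xi\cdot\eta-\phi(\xi))$, and for an $\mathcal N$-function $\psi$ let $\|\xi\|_{\psi,\Omega}=\inf\{\lambda>0:\int_\Omega\psi(\xi(x)/\lambda)\,dx\le1\}$ be the Luxemburg norm. Let $r\ge1$ be an integer such that $H^{r-1}(\Omega;\mathbb R^d)\hookrightarrow L^\infty(\Omega;\mathbb R^d)$ continuously. Let $H=H^r(\Omega)\cap H^1_0(\Omega)$ with the inner product $(w,z)_r=\sum_{|\alpha|\le r}(\partial^\alpha w,\partial^\alpha z)_{L^2(\Omega)}$ and norm $\|\cdot\|_r$,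 and for $z\in L^2(\Omega)$ let $\|z\|_{H^*}=\sup_{w\in H\setminus\{0\}}|(z,w)_{L^2(\Omega)}|/\|w\|_r$. Let $(e_j)_{j\ge1}$ be an orthonormal basis of $L^2(\Omega)$ with $e_j\in H$ and $\mu_j(e_j,z)_r=(e_j,z)_{L^2(\Omega)}$ for all $z\in H$, where $\mu_j>0$ and $\mu_j\to0$. Put $V_m=\operatorname{span}\{\sqrt{\mu_1}\,e_1,\dots,\sqrt{\mu_m}\,e_m\}$. Let $N\ge1$, $\tau=T/N$, $f\in L^1(0,T;L^2(\Omega))$ and $f^n=\frac1\tau\int_{(n-1)\tau}^{n\tau}f(\cdot,t)\,dt$. Given $u^0,v^0\in V_m$, let $(u^n)_{n=1}^N,(v^n)_{n=1}^N\subset V_m$ be a solution of the scheme $$\int_\Omega\Big(\frac{v^n-v^{n-1}}{\tau}\,\psi+\nabla v^n\cdot\nabla\psi+\sigma(\nabla u^n)\cdot\nabla\psi\Big)dx=\int_\Omega f^n\psi\,dx\quad\text{for all }\psi\in V_m,\qquad \frac{u^n-u^{n-1}}{\tau}=v^n,\qquad n=1,\dots,N.$$ (a) There is a constant $C>0$,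 depending only on $d,\Omega,T,\phi,\sigma,r$ (hence independent of the basis $(e_j)$, of $m$, $N$, $f$, $u^0$, $v^0$ and of the discrete solution), such that $$\tau\sum_{n=1}^N\Big\|\frac{v^n-v^{n-1}}{\tau}\Big\|_{H^*}\le C\Big(\|v^0\|_{L^2(\Omega)}+\Big(\int_\Omega\phi(\nabla u^0)\,dx\Big)^{1/2}+\|f\|_{L^1(0,T;L^2(\Omega))}+\max_{n=1,\dots,N}\|\sigma(\nabla u^n)\|_{\phi^*,\Omega}\Big).$$ (b) For every $\delta>0$ there is a constant $C>0$, depending only on $\delta,d,\Omega,T,\phi,\sigma,r$, such that whenever $u^0=0$ or $\int_\Omega\phi(\nabla u^0)\,dx\ge\delta$, $$\tau\sum_{n=1}^N\Big\|\frac{v^n-v^{n-1}}{\tau}\Big\|_{H^*}\le C\Big(\|v^0\|_{L^2(\Omega)}+\int_\Omega\phi(\nabla u^0)\,dx+\|f\|_{L^1(0,T;L^2(\Omega))}+\max_{n=1,\dots,N}\|\sigma(\nabla u^n)\|_{\phi^*,\Omega}\Big).$$ -/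

import Mathlib

open MeasureTheory Filter Topology
open scoped ContDiff

noncomputable section

namespace Elastodynamics

/-- Euclidean space `ℝ^d`. -/
abbrev Eucl (d : ℕ) : Type := EuclideanSpace ℝ (Fin d)

/-- The real Hilbert space `L²(Ω)`. -/
abbrev L2 {d : ℕ} (Ω : Set (Eucl d)) : Type := Lp ℝ 2 (volume.restrict Ω)

/-! ### `N`-functions, conjugate functions, Luxemburg norms -/

/-- `N`-functions with vector-valued argument. -/
structure IsNFunction {d : ℕ} (φ : Eucl d → ℝ) : Prop where
  continuous : Continuous φ
  eq_zero_iff : ∀ ξ, φ ξ = 0 ↔ ξ = 0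
  even : ∀ ξ, φ (-ξ) = φ ξ
  convex : ConvexOn ℝ Set.univ φ
  superlinear : Tendsto (fun ξ => φ ξ / ‖ξ‖) (Bornology.cobounded (Eucl d)) atTop
  sublinear_at_zero : Tendsto (fun ξ => φ ξ / ‖ξ‖) (𝓝[≠] 0) (𝓝 0)

/-- The Legendre-Fenchel transform `φ*(η) = sup_ξ (ξ · η - φ(ξ))`; the supremum is finite for
functions of superlinear growth, in particular for `N`-functions. -/
def conjugate {d : ℕ} (φ : Eucl d → ℝ) (η : Eucl d) : ℝ :=
  ⨆ ξ : Eucl d, (inner ℝ ξ η - φ ξ)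

/-- The Luxemburg norm `inf {lam > 0 | ∫_Ω φ(ξ(x) / lam) dx ≤ 1}`. The integral of the nonnegative
function `φ(ξ(x) / lam)` is taken in `[0, ∞]`. -/
def luxemburgNorm {d : ℕ} (φ : Eucl d → ℝ) (Ω : Set (Eucl d)) (ξ : Eucl d → Eucl d) : ℝ :=
  sInf {lam : ℝ | 0 < lam ∧ ∫⁻ x in Ω, ENNReal.ofReal (φ (lam⁻¹ • ξ x)) ≤ 1}

/-! ### Weak derivatives and Sobolev spaces on `Ω` -/

/-- Classical partial derivative in the `i`-th coordinate direction. -/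
def partialDeriv {d : ℕ} (i : Fin d) (ψ : Eucl d → ℝ) (x : Eucl d) : ℝ :=
  fderiv ℝ ψ x (EuclideanSpace.single i 1)

/-- Classical derivative `∂^α` for a multi-index `α`. -/
def multiDeriv {d : ℕ} (α : Fin d → ℕ) (ψ : Eucl d → ℝ) : Eucl d → ℝ :=
  (List.finRange d).foldr (fun i g => (partialDeriv i)^[α i] g) ψ

/-- `ψ ∈ C_c^∞(Ω)`. -/
structure IsTestFunction {d : ℕ} (Ω : Set (Eucl d)) (ψ : Eucl d → ℝ) : Prop where
  smooth : ContDiff ℝ ∞ ψ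
  compact : HasCompactSupport ψ
  support_subset : tsupport ψ ⊆ Ω

/-- `g ∈ L²(Ω)` is the weak derivative `∂^α w` of `w ∈ L²(Ω)` on `Ω`. -/
def HasWeakDeriv {d : ℕ} {Ω : Set (Eucl d)} (α : Fin d → ℕ) (w g : L2 Ω) : Prop :=
  ∀ ψ : Eucl d → ℝ, IsTestFunction Ω ψ →
    ∫ x in Ω, w x * multiDeriv α ψ x = (-1) ^ (∑ i, α i) * ∫ x in Ω, g x * ψ x

open Classical in
/-- The weak derivative `∂^α w` in `L²(Ω)` (set to `0` if there is none); on an open set it is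
unique. -/
def weakDeriv {d : ℕ} {Ω : Set (Eucl d)} (α : Fin d → ℕ) (w : L2 Ω) : L2 Ω :=
  if h : ∃ g, HasWeakDeriv α w g then h.choose else 0

/-- The weak gradient, as an `ℝ^d`-valued function. -/
def weakGrad {d : ℕ} {Ω : Set (Eucl d)} (w : L2 Ω) (x : Eucl d) : Eucl d :=
  WithLp.toLp 2 (fun i => weakDeriv (Pi.single i 1) w x)

/-- The multi-indices of order at most `k`. -/
def multiIndices (d k : ℕ) : Finset (Fin d → ℕ) :=
  (Fintype.piFinset fun _ => Finset.range (k + 1)).filter fun α => ∑ i, α i ≤ k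

/-- `w ∈ H^k(Ω)`: all weak derivatives up to order `k` are in `L²(Ω)`. -/
def MemH {d : ℕ} {Ω : Set (Eucl d)} (k : ℕ) (w : L2 Ω) : Prop :=
  ∀ α ∈ multiIndices d k, ∃ g, HasWeakDeriv α w g

/-- The canonical inner product of `H^k(Ω)`. -/
def sobolevInner {d : ℕ} {Ω : Set (Eucl d)} (k : ℕ) (w z : L2 Ω) : ℝ :=
  ∑ α ∈ multiIndices d k, inner ℝ (weakDeriv α w) (weakDeriv α z)

/-- The norm of `H^k(Ω)`. -/
def sobolevNorm {d : ℕ} {Ω : Set (Eucl d)} (k : ℕ) (w : L2 Ω) : ℝ :=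
  √(sobolevInner k w w)

/-- `w ∈ H^1_0(Ω)`, the closure of `C_c^∞(Ω)` in `H^1(Ω)`. -/
def MemH10 {d : ℕ} {Ω : Set (Eucl d)} (w : L2 Ω) : Prop :=
  MemH 1 w ∧ ∀ ε > 0, ∃ (ψ : Eucl d → ℝ) (z : L2 Ω), IsTestFunction Ω ψ ∧
    z =ᵐ[volume.restrict Ω] ψ ∧ sobolevNorm 1 (w - z) < ε

/-- The Hilbert space `H^r(Ω) ∩ H^1_0(Ω)`, with the inner product of `H^r(Ω)`. -/
def MemHr {d : ℕ} {Ω : Set (Eucl d)} (r : ℕ) (w : L2 Ω) : Prop :=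
  MemH r w ∧ MemH10 w

/-- The norm in the dual of `H^r(Ω) ∩ H^1_0(Ω)` of the functional `w ↦ (z, w)_{L²(Ω)}`. -/
def dualNorm {d : ℕ} {Ω : Set (Eucl d)} (r : ℕ) (z : L2 Ω) : ℝ :=
  sSup {a : ℝ | ∃ w : L2 Ω, MemHr r w ∧ w ≠ 0 ∧ a = |inner ℝ z w| / sobolevNorm r w}

/-- The continuous embedding `H^k(Ω; ℝ^d) ↪ L^∞(Ω; ℝ^d)`. -/
def EmbedsInLinfty {d : ℕ} (Ω : Set (Eucl d)) (k : ℕ) : Prop :=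
  ∃ K : ℝ, ∀ w : Fin d → L2 Ω, (∀ i, MemH k (w i)) →
    ∀ᵐ x ∂(volume.restrict Ω),
      ‖(WithLp.toLp 2 (fun i => w i x) : Eucl d)‖ ≤ K * √(∑ i, sobolevNorm k (w i) ^ 2)

/-! ### The Galerkin scheme -/

/-- `w` is the image of `g ∈ L²(Ω)` under the solution operator: `w ∈ H^r(Ω) ∩ H^1_0(Ω)` and
`(w, z)_r = (g, z)` for all `z ∈ H^r(Ω) ∩ H^1_0(Ω)`. -/
def IsSolutionFor {d : ℕ} {Ω : Set (Eucl d)} (r : ℕ) (g w : L2 Ω) : Prop :=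
  MemHr r w ∧ ∀ z : L2 Ω, MemHr r z → sobolevInner r w z = inner ℝ g z

/-- `e` is an orthonormal basis of `L²(Ω)` of eigenfunctions of the solution operator, with
positive eigenvalues `μ j → 0`. -/
structure IsEigenbasis {d : ℕ} {Ω : Set (Eucl d)} (r : ℕ) (e : HilbertBasis ℕ ℝ (L2 Ω))
    (μ : ℕ → ℝ) : Prop where
  pos : ∀ j, 0 < μ j
  tendsto_zero : Tendsto μ atTop (𝓝 0)
  eigen : ∀ j, IsSolutionFor r (e j) (μ j • e j)

/-- `V_m`, the span of the first `m` functions `√(μ j) e j`. -/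
def galerkinSpace {d : ℕ} {Ω : Set (Eucl d)} (e : HilbertBasis ℕ ℝ (L2 Ω)) (μ : ℕ → ℝ) (m : ℕ) :
    Submodule ℝ (L2 Ω) :=
  Submodule.span ℝ ((fun j => √(μ j) • e j) '' Set.Iio m)

/-- The time average of `f` over `(t_{n-1}, t_n)`, where `t_n = n τ`. -/
def timeAverage {d : ℕ} {Ω : Set (Eucl d)} (τ : ℝ) (f : ℝ → L2 Ω) (n : ℕ) : L2 Ω :=
  τ⁻¹ • ∫ t in (((n : ℝ) - 1) * τ)..((n : ℝ) * τ), f t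

/-- `(u n), (v n)`, `n = 0, …, N`, is a solution in `W` of the fully discrete scheme with step size
`τ`, starting from `u 0, v 0 ∈ W`. -/
structure IsDiscreteSolution {d : ℕ} {Ω : Set (Eucl d)} (σ : Eucl d → Eucl d) (τ : ℝ) (N : ℕ)
    (W : Submodule ℝ (L2 Ω)) (f : ℝ → L2 Ω) (u v : ℕ → L2 Ω) : Prop where
  mem_u : ∀ n ≤ N, u n ∈ W
  mem_v : ∀ n ≤ N, v n ∈ W
  momentum : ∀ n ∈ Finset.Icc 1 N, ∀ ψ ∈ W,
    ∫ x in Ω, ((τ⁻¹ • (v n - v (n - 1))) x * ψ x + inner ℝ (weakGrad (v n) x) (weakGrad ψ x)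
        + inner ℝ (σ (weakGrad (u n) x)) (weakGrad ψ x))
      = ∫ x in Ω, timeAverage τ f n x * ψ x
  velocity : ∀ n ∈ Finset.Icc 1 N, τ⁻¹ • (u n - u (n - 1)) = v n

/-- `max_{n = 1, …, N} ‖σ(∇u^n)‖_{φ*,Ω}`. -/
def maxStressNorm {d : ℕ} {Ω : Set (Eucl d)} (φ : Eucl d → ℝ) (σ : Eucl d → Eucl d) (N : ℕ)
    (hN : 1 ≤ N) (u : ℕ → L2 Ω) : ℝ :=
  (Finset.Icc 1 N).sup' (Finset.nonempty_Icc.mpr hN)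
    fun n => luxemburgNorm (conjugate φ) Ω fun x => σ (weakGrad (u n) x)

end Elastodynamics

end

namespace Elastodynamics

/-! ### Classical derivatives of smooth functions -/

/-! The scheme only tests with `V_m`, whereas the dual norm tests with all of `H`. The eigenrelation
makes the `e j` orthogonal both in `L²` and in `H^r`, so the truncated `L²` expansion of `w ∈ H` is
also its `H^r`-orthogonal projection onto `V_m`. It does not increase `‖w‖_r` and does not change
the pairing with elements of `V_m`. Hence a bound on `V_m` passes to `H` with the same constant,
independent of `m` and of the basis (`exists_projection`, `dualNorm_le`).

On `V_m` the equation expresses the difference quotient by three terms. The source costs `‖f^n‖`.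
The viscous term costs `√d ‖∇v^n‖`. For the stress, the embedding bounds `∇ψ / ‖ψ‖_r` by a fixed
`K`, and Young's inequality gives a multiple of the Luxemburg norm of `σ(∇u^n)`
(`integral_inner_le_luxemburgNorm`).

To sum the viscous part over time, test with `v^n`. Convexity of `φ` turns the stress into an
increment of `∫ φ(∇u^n)`, and a Gronwall argument for the square root of the energy bounds `τ ∑
‖∇v^n‖²` by the square of an expression linear in `‖v^0‖`, `(∫ φ(∇u^0))^{1/2}` and `‖f‖`
(`energy_inequality`, `sum_le_sq_of_energy_inequality`). Cauchy-Schwarz in time concludes (a). Part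
(b) only compares `√E` with `E`. -/

theorem contDiff_partialDeriv {d : ℕ} (i : Fin d) {ψ : Eucl d → ℝ} (h : ContDiff ℝ ∞ ψ) :
    ContDiff ℝ ∞ (partialDeriv i ψ) :=
  (h.fderiv_right (m := ∞) le_rfl).clm_apply contDiff_const

theorem partialDeriv_comm {d : ℕ} (i j : Fin d) {ψ : Eucl d → ℝ} (h : ContDiff ℝ ∞ ψ) :
    partialDeriv i (partialDeriv j ψ) = partialDeriv j (partialDeriv i ψ) := by
  have key : ∀ (i j : Fin d) (x : Eucl d), partialDeriv i (partialDeriv j ψ) x =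
      fderiv ℝ (fderiv ℝ ψ) x (EuclideanSpace.single i 1) (EuclideanSpace.single j 1) := by
    intro i j x
    have hd : DifferentiableAt ℝ (fderiv ℝ ψ) x :=
      (h.fderiv_right (m := ∞) le_rfl).differentiable (by simp) x
    have : partialDeriv j ψ = fun y => fderiv ℝ ψ y (EuclideanSpace.single j 1) := rfl
    rw [this, partialDeriv, fderiv_clm_apply hd (differentiableAt_const _)]
    simp
  funext x
  rw [key, key]
  have hs : IsSymmSndFDerivAt ℝ ψ x :=
    (h.contDiffAt (x := x)).isSymmSndFDerivAt
      (by rw [minSmoothness_of_isRCLikeNormedField]; exact ENat.LEInfty.out)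
  exact hs _ _

theorem contDiff_iterate_partialDeriv {d : ℕ} (i : Fin d) (k : ℕ) {ψ : Eucl d → ℝ}
    (h : ContDiff ℝ ∞ ψ) : ContDiff ℝ ∞ ((partialDeriv i)^[k] ψ) := by
  induction k with
  | zero => exact h
  | succ k ih => rw [Function.iterate_succ_apply']; exact contDiff_partialDeriv i ih

theorem iterate_partialDeriv_comm {d : ℕ} (i j : Fin d) (k : ℕ) {ψ : Eucl d → ℝ}
    (h : ContDiff ℝ ∞ ψ) :
    (partialDeriv j)^[k] (partialDeriv i ψ) = partialDeriv i ((partialDeriv j)^[k] ψ) := by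
  induction k with
  | zero => rfl
  | succ k ih =>
    rw [Function.iterate_succ_apply', Function.iterate_succ_apply', ih,
      partialDeriv_comm _ _ (contDiff_iterate_partialDeriv j k h)]

theorem contDiff_foldr_partialDeriv {d : ℕ} (α : Fin d → ℕ) {ψ : Eucl d → ℝ}
    (h : ContDiff ℝ ∞ ψ) (l : List (Fin d)) :
    ContDiff ℝ ∞ (l.foldr (fun i g => (partialDeriv i)^[α i] g) ψ) := by
  induction l with
  | nil => exact h
  | cons j l ih => exact contDiff_iterate_partialDeriv j _ ih

theorem foldr_partialDeriv_add_single_of_notMem {d : ℕ} (α : Fin d → ℕ) (i : Fin d)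
    (ψ : Eucl d → ℝ) (l : List (Fin d)) (hi : i ∉ l) :
    l.foldr (fun j g => (partialDeriv j)^[(α + Pi.single i 1 : Fin d → ℕ) j] g) ψ =
      l.foldr (fun j g => (partialDeriv j)^[α j] g) ψ := by
  induction l with
  | nil => rfl
  | cons j l ih =>
    rw [List.mem_cons, not_or] at hi
    rw [List.foldr_cons, List.foldr_cons, ih hi.2, Pi.add_apply,
      Pi.single_eq_of_ne (Ne.symm hi.1), add_zero]

/-- The index `i` occurs exactly once in the list; the extra derivative arising there commutes past
the derivatives applied later. -/
theorem foldr_partialDeriv_add_single {d : ℕ} (α : Fin d → ℕ) (i : Fin d) {ψ : Eucl d → ℝ}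
    (h : ContDiff ℝ ∞ ψ) (l : List (Fin d)) (hl : l.Nodup) (hi : i ∈ l) :
    l.foldr (fun j g => (partialDeriv j)^[(α + Pi.single i 1 : Fin d → ℕ) j] g) ψ =
      partialDeriv i (l.foldr (fun j g => (partialDeriv j)^[α j] g) ψ) := by
  induction l with
  | nil => simp at hi
  | cons j l ih =>
    rw [List.nodup_cons] at hl
    rw [List.foldr_cons, List.foldr_cons]
    rcases eq_or_ne i j with rfl | hij
    · rw [foldr_partialDeriv_add_single_of_notMem α i ψ l hl.1, Pi.add_apply, Pi.single_eq_same,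
        Function.iterate_succ_apply']
    · have hil : i ∈ l := (List.mem_cons.mp hi).resolve_left hij
      rw [ih hl.2 hil, Pi.add_apply, Pi.single_eq_of_ne (Ne.symm hij), add_zero,
        iterate_partialDeriv_comm _ _ _ (contDiff_foldr_partialDeriv α h l)]

theorem multiDeriv_add_single {d : ℕ} (α : Fin d → ℕ) (i : Fin d) {ψ : Eucl d → ℝ}
    (h : ContDiff ℝ ∞ ψ) :
    multiDeriv (α + Pi.single i 1) ψ = partialDeriv i (multiDeriv α ψ) :=
  foldr_partialDeriv_add_single α i h _ (List.nodup_finRange d) (List.mem_finRange i)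

theorem multiDeriv_zero {d : ℕ} (ψ : Eucl d → ℝ) : multiDeriv 0 ψ = ψ := by
  have : ∀ l : List (Fin d),
      l.foldr (fun i g => (partialDeriv i)^[(0 : Fin d → ℕ) i] g) ψ = ψ := by
    intro l
    induction l with
    | nil => rfl
    | cons j l ih => rw [List.foldr_cons, ih]; rfl
  exact this _

theorem multiDeriv_single {d : ℕ} (i : Fin d) {ψ : Eucl d → ℝ} (h : ContDiff ℝ ∞ ψ) :
    multiDeriv (Pi.single i 1) ψ = partialDeriv i ψ := by
  simpa [multiDeriv_zero] using multiDeriv_add_single 0 i h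

theorem IsTestFunction.partialDeriv {d : ℕ} {Ω : Set (Eucl d)} {ψ : Eucl d → ℝ}
    (h : IsTestFunction Ω ψ) (i : Fin d) : IsTestFunction Ω (partialDeriv i ψ) where
  smooth := contDiff_partialDeriv i h.smooth
  compact := h.compact.fderiv_apply ℝ _
  support_subset := (tsupport_fderiv_apply_subset ℝ _).trans h.support_subset

theorem IsTestFunction.multiDeriv {d : ℕ} {Ω : Set (Eucl d)} {ψ : Eucl d → ℝ}
    (h : IsTestFunction Ω ψ) (α : Fin d → ℕ) : IsTestFunction Ω (multiDeriv α ψ) := by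
  have iter : ∀ (i : Fin d) (k : ℕ) {ψ : Eucl d → ℝ}, IsTestFunction Ω ψ →
      IsTestFunction Ω ((Elastodynamics.partialDeriv i)^[k] ψ) := by
    intro i k ψ h
    induction k with
    | zero => exact h
    | succ k ih => rw [Function.iterate_succ_apply']; exact ih.partialDeriv i
  have : ∀ l : List (Fin d),
      IsTestFunction Ω (l.foldr (fun i g => (Elastodynamics.partialDeriv i)^[α i] g) ψ) := by
    intro l
    induction l with
    | nil => exact h
    | cons j l ih => exact iter j _ ih
  exact this _

/-! ### Weak derivatives -/

theorem IsTestFunction.memLp {d : ℕ} {Ω : Set (Eucl d)} {ψ : Eucl d → ℝ}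
    (h : IsTestFunction Ω ψ) : MemLp ψ 2 (volume.restrict Ω) :=
  h.smooth.continuous.memLp_of_hasCompactSupport h.compact

theorem integral_mul_eq_inner {d : ℕ} {Ω : Set (Eucl d)} (w z : L2 Ω) :
    ∫ x in Ω, w x * z x = inner ℝ w z := by
  rw [L2.inner_def]
  exact integral_congr_ae (.of_forall fun x => by simp [mul_comm])

theorem IsTestFunction.integral_mul {d : ℕ} {Ω : Set (Eucl d)} {ψ : Eucl d → ℝ}
    (h : IsTestFunction Ω ψ) (w : L2 Ω) :
    ∫ x in Ω, w x * ψ x = inner ℝ w h.memLp.toLp := by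
  rw [← integral_mul_eq_inner]
  refine integral_congr_ae ?_
  filter_upwards [h.memLp.coeFn_toLp] with x hx
  rw [hx]

theorem hasWeakDeriv_iff {d : ℕ} {Ω : Set (Eucl d)} {α : Fin d → ℕ} {w g : L2 Ω} :
    HasWeakDeriv α w g ↔ ∀ ψ : Eucl d → ℝ, ∀ h : IsTestFunction Ω ψ,
      inner ℝ w (h.multiDeriv α).memLp.toLp = (-1) ^ (∑ i, α i) * inner ℝ g h.memLp.toLp := by
  refine forall_congr' fun ψ => forall_congr' fun h => ?_
  rw [h.integral_mul, (h.multiDeriv α).integral_mul]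

theorem HasWeakDeriv.add {d : ℕ} {Ω : Set (Eucl d)} {α : Fin d → ℕ} {w g w' g' : L2 Ω}
    (h : HasWeakDeriv α w g) (h' : HasWeakDeriv α w' g') : HasWeakDeriv α (w + w') (g + g') := by
  rw [hasWeakDeriv_iff] at *
  intro ψ hψ
  rw [inner_add_left, inner_add_left, h ψ hψ, h' ψ hψ, mul_add]

theorem HasWeakDeriv.const_smul {d : ℕ} {Ω : Set (Eucl d)} {α : Fin d → ℕ} {w g : L2 Ω}
    (c : ℝ) (h : HasWeakDeriv α w g) : HasWeakDeriv α (c • w) (c • g) := by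
  rw [hasWeakDeriv_iff] at *
  intro ψ hψ
  rw [inner_smul_left, inner_smul_left, h ψ hψ, mul_left_comm]

theorem hasWeakDeriv_zero {d : ℕ} {Ω : Set (Eucl d)} (α : Fin d → ℕ) :
    HasWeakDeriv α (0 : L2 Ω) 0 := by
  rw [hasWeakDeriv_iff]
  intro ψ hψ
  rw [inner_zero_left, inner_zero_left, mul_zero]

theorem hasWeakDeriv_self {d : ℕ} {Ω : Set (Eucl d)} (w : L2 Ω) : HasWeakDeriv 0 w w := by
  intro ψ _
  simp [multiDeriv_zero]

theorem isFiniteMeasure_restrict {d : ℕ} {Ω : Set (Eucl d)} (hΩb : Bornology.IsBounded Ω) :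
    IsFiniteMeasure (volume.restrict Ω) :=
  ⟨by rw [Measure.restrict_apply_univ]; exact hΩb.measure_lt_top⟩

theorem eq_zero_of_inner_testFunction {d : ℕ} {Ω : Set (Eucl d)} (hΩ : IsOpen Ω)
    (hΩb : Bornology.IsBounded Ω) {g : L2 Ω}
    (h : ∀ ψ : Eucl d → ℝ, ∀ hψ : IsTestFunction Ω ψ, inner ℝ g hψ.memLp.toLp = 0) : g = 0 := by
  have := isFiniteMeasure_restrict hΩb
  have hint : Integrable g (volume.restrict Ω) := (Lp.memLp g).integrable one_le_two
  have key := hΩ.ae_eq_zero_of_integral_contDiff_smul_eq_zero (f := g)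
    (hint.locallyIntegrable.locallyIntegrableOn Ω) (fun ψ h1 h2 h3 => by
      have := h ψ ⟨h1, h2, h3⟩
      rw [← IsTestFunction.integral_mul ⟨h1, h2, h3⟩] at this
      rw [← this]
      exact integral_congr_ae (.of_forall fun x => by simp [mul_comm]))
  rw [Lp.eq_zero_iff_ae_eq_zero]
  filter_upwards [key, ae_restrict_mem hΩ.measurableSet] with x h1 h2
  exact h1 h2

/-- `weakDeriv` is defined by choice; uniqueness, from the fundamental lemma of the calculus of
variations, is what makes it computable and linear. -/
theorem HasWeakDeriv.unique {d : ℕ} {Ω : Set (Eucl d)} (hΩ : IsOpen Ω)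
    (hΩb : Bornology.IsBounded Ω) {α : Fin d → ℕ} {w g g' : L2 Ω}
    (h : HasWeakDeriv α w g) (h' : HasWeakDeriv α w g') : g = g' := by
  rw [← sub_eq_zero]
  refine eq_zero_of_inner_testFunction hΩ hΩb fun ψ hψ => ?_
  rw [hasWeakDeriv_iff] at h h'
  have := (h ψ hψ).symm.trans (h' ψ hψ)
  rw [inner_sub_left, sub_eq_zero]
  exact mul_left_cancel₀ (pow_ne_zero _ (by norm_num)) this

theorem HasWeakDeriv.weakDeriv_eq {d : ℕ} {Ω : Set (Eucl d)} (hΩ : IsOpen Ω)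
    (hΩb : Bornology.IsBounded Ω) {α : Fin d → ℕ} {w g : L2 Ω} (h : HasWeakDeriv α w g) :
    weakDeriv α w = g := by
  have hex : ∃ g, HasWeakDeriv α w g := ⟨g, h⟩
  rw [weakDeriv, dif_pos hex]
  exact hex.choose_spec.unique hΩ hΩb h

/-- Test the first-order derivative against `∂^α ψ`; one factor `-1` on each side cancels. -/
theorem HasWeakDeriv.of_add_single {d : ℕ} {Ω : Set (Eucl d)} {α : Fin d → ℕ} {i : Fin d}
    {w g h : L2 Ω} (hg : HasWeakDeriv (α + Pi.single i 1) w g)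
    (hh : HasWeakDeriv (Pi.single i 1) w h) : HasWeakDeriv α h g := by
  intro ψ hψ
  have h1 := hh _ (hψ.multiDeriv α)
  have h2 := hg ψ hψ
  rw [multiDeriv_single i (hψ.multiDeriv α).smooth, ← multiDeriv_add_single α i hψ.smooth, h2] at h1
  simp only [Pi.add_apply, Finset.sum_add_distrib, Finset.sum_pi_single', Finset.mem_univ,
    if_true, pow_succ] at h1
  linarith

/-! ### Sobolev spaces -/

theorem mem_multiIndices {d k : ℕ} {α : Fin d → ℕ} : α ∈ multiIndices d k ↔ ∑ i, α i ≤ k := by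
  rw [multiIndices, Finset.mem_filter, Fintype.mem_piFinset, and_iff_right_iff_imp]
  intro h i
  rw [Finset.mem_range, Nat.lt_succ_iff]
  exact (Finset.single_le_sum (fun j _ => Nat.zero_le (α j)) (Finset.mem_univ i)).trans h

theorem sum_add_single {d : ℕ} (α : Fin d → ℕ) (i : Fin d) :
    ∑ j, (α + Pi.single i 1 : Fin d → ℕ) j = ∑ j, α j + 1 := by
  simp [Finset.sum_add_distrib]

theorem add_single_mem_multiIndices {d k : ℕ} (hk : 1 ≤ k) {α : Fin d → ℕ} (i : Fin d)
    (h : α ∈ multiIndices d (k - 1)) : α + Pi.single i 1 ∈ multiIndices d k := by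
  rw [mem_multiIndices] at *
  rw [sum_add_single]
  omega

theorem single_mem_multiIndices {d k : ℕ} (hk : 1 ≤ k) (i : Fin d) :
    Pi.single i 1 ∈ multiIndices d k := by
  simpa using add_single_mem_multiIndices hk i (α := 0) (by simp [mem_multiIndices])

/-- `H^k(Ω)` as a subspace of `L²(Ω)`. -/
def sobolevSpace {d : ℕ} (Ω : Set (Eucl d)) (k : ℕ) : Submodule ℝ (L2 Ω) where
  carrier := {w | MemH k w}
  zero_mem' := fun α _ => ⟨0, hasWeakDeriv_zero α⟩
  add_mem' := fun h h' α hα =>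
    ⟨_, (h α hα).choose_spec.add (h' α hα).choose_spec⟩
  smul_mem' := fun c _ h α hα => ⟨_, (h α hα).choose_spec.const_smul c⟩

theorem MemH.hasWeakDeriv {d k : ℕ} {Ω : Set (Eucl d)} {w : L2 Ω} (h : MemH k w)
    {α : Fin d → ℕ} (hα : α ∈ multiIndices d k) : HasWeakDeriv α w (weakDeriv α w) := by
  rw [weakDeriv, dif_pos (h α hα)]
  exact (h α hα).choose_spec

/-- The derivatives up to order `k`, as a linear map on `H^k(Ω)`. -/
noncomputable def jet {d : ℕ} {Ω : Set (Eucl d)} (hΩ : IsOpen Ω) (hΩb : Bornology.IsBounded Ω) (k : ℕ) :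
    sobolevSpace Ω k →ₗ[ℝ] PiLp 2 (fun _ : multiIndices d k => L2 Ω) where
  toFun w := WithLp.toLp 2 fun α => weakDeriv α (w : L2 Ω)
  map_add' w z := by
    ext1 α
    exact ((MemH.hasWeakDeriv w.2 α.2).add (MemH.hasWeakDeriv z.2 α.2)).weakDeriv_eq hΩ hΩb
  map_smul' c w := by
    ext1 α
    exact ((MemH.hasWeakDeriv w.2 α.2).const_smul c).weakDeriv_eq hΩ hΩb

/-- Pulling the Sobolev inner product back from a genuine Hilbert space supplies bilinearity and
Cauchy-Schwarz. -/
theorem sobolevInner_eq_inner_jet {d k : ℕ} {Ω : Set (Eucl d)} (hΩ : IsOpen Ω)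
    (hΩb : Bornology.IsBounded Ω) (w z : sobolevSpace Ω k) :
    sobolevInner k (w : L2 Ω) z = inner ℝ (jet hΩ hΩb k w) (jet hΩ hΩb k z) := by
  rw [PiLp.inner_apply, sobolevInner]
  exact (Finset.sum_coe_sort (multiIndices d k)
    fun α => inner ℝ (weakDeriv α (w : L2 Ω)) (weakDeriv α (z : L2 Ω))).symm

theorem sobolevNorm_eq_norm_jet {d k : ℕ} {Ω : Set (Eucl d)} (hΩ : IsOpen Ω)
    (hΩb : Bornology.IsBounded Ω) (w : sobolevSpace Ω k) :
    sobolevNorm k (w : L2 Ω) = ‖jet hΩ hΩb k w‖ := by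
  rw [sobolevNorm, sobolevInner_eq_inner_jet hΩ hΩb, real_inner_self_eq_norm_sq,
    Real.sqrt_sq (norm_nonneg _)]

theorem sobolevNorm_nonneg {d k : ℕ} {Ω : Set (Eucl d)} (w : L2 Ω) : 0 ≤ sobolevNorm k w :=
  Real.sqrt_nonneg _

theorem sobolevNorm_sq {d k : ℕ} {Ω : Set (Eucl d)} (w : L2 Ω) :
    sobolevNorm k w ^ 2 = ∑ α ∈ multiIndices d k, ‖weakDeriv α w‖ ^ 2 := by
  have : sobolevInner k w w = ∑ α ∈ multiIndices d k, ‖weakDeriv α w‖ ^ 2 :=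
    Finset.sum_congr rfl fun α _ => real_inner_self_eq_norm_sq _
  rw [sobolevNorm, Real.sq_sqrt, this]
  rw [this]
  positivity

theorem norm_weakDeriv_le_sobolevNorm {d k : ℕ} {Ω : Set (Eucl d)} {α : Fin d → ℕ}
    (hα : α ∈ multiIndices d k) (w : L2 Ω) : ‖weakDeriv α w‖ ≤ sobolevNorm k w := by
  refine le_of_sq_le_sq ?_ (sobolevNorm_nonneg w)
  rw [sobolevNorm_sq]
  exact Finset.single_le_sum (f := fun α => ‖weakDeriv α w‖ ^ 2) (fun _ _ => by positivity) hα

theorem norm_le_sobolevNorm {d k : ℕ} {Ω : Set (Eucl d)} (hΩ : IsOpen Ω)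
    (hΩb : Bornology.IsBounded Ω) (w : L2 Ω) : ‖w‖ ≤ sobolevNorm k w := by
  have := norm_weakDeriv_le_sobolevNorm (k := k) (α := 0) (by simp [mem_multiIndices]) w
  rwa [(hasWeakDeriv_self w).weakDeriv_eq hΩ hΩb] at this

theorem MemH.weakDeriv_single {d k : ℕ} {Ω : Set (Eucl d)} (hk : 1 ≤ k) {w : L2 Ω}
    (h : MemH k w) (i : Fin d) : MemH (k - 1) (weakDeriv (Pi.single i 1) w) := fun _ hα =>
  ⟨_, (h.hasWeakDeriv (add_single_mem_multiIndices hk i hα)).of_add_single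
    (h.hasWeakDeriv (single_mem_multiIndices hk i))⟩

/-- The shift of `α` by the `i`-th unit index is injective into the indices of order at most `k`, so
the left sum of squares is part of the right one. -/
theorem MemH.sobolevNorm_weakDeriv_single_le {d k : ℕ} {Ω : Set (Eucl d)} (hΩ : IsOpen Ω)
    (hΩb : Bornology.IsBounded Ω) (hk : 1 ≤ k) {w : L2 Ω} (h : MemH k w) (i : Fin d) :
    sobolevNorm (k - 1) (weakDeriv (Pi.single i 1) w) ≤ sobolevNorm k w := by
  refine le_of_sq_le_sq ?_ (sobolevNorm_nonneg w)
  rw [sobolevNorm_sq, sobolevNorm_sq]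
  have h1 : ∀ α ∈ multiIndices d (k - 1),
      ‖weakDeriv α (weakDeriv (Pi.single i 1) w)‖ ^ 2 =
        ‖weakDeriv (α + Pi.single i 1) w‖ ^ 2 := fun α hα => by
    rw [((h.hasWeakDeriv (add_single_mem_multiIndices hk i hα)).of_add_single
      (h.hasWeakDeriv (single_mem_multiIndices hk i))).weakDeriv_eq hΩ hΩb]
  rw [Finset.sum_congr rfl h1,
    ← Finset.sum_image (f := fun α => ‖weakDeriv α w‖ ^ 2) (g := fun α => α + Pi.single i 1)
      fun α _ β _ hαβ => add_right_cancel hαβ]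
  refine Finset.sum_le_sum_of_subset_of_nonneg ?_ fun _ _ _ => by positivity
  intro β hβ
  obtain ⟨α, hα, rfl⟩ := Finset.mem_image.mp hβ
  exact add_single_mem_multiIndices hk i hα

/-! ### The weak gradient -/

theorem aestronglyMeasurable_weakGrad {d : ℕ} {Ω : Set (Eucl d)} (w : L2 Ω) :
    AEStronglyMeasurable (weakGrad w) (volume.restrict Ω) := by
  refine (PiLp.continuous_toLp 2 _).comp_aestronglyMeasurable ?_
  refine AEMeasurable.aestronglyMeasurable ?_
  exact aemeasurable_pi_iff.mpr fun i => (Lp.aestronglyMeasurable _).aemeasurable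

theorem weakGrad_add_smul {d k : ℕ} {Ω : Set (Eucl d)} (hΩ : IsOpen Ω)
    (hΩb : Bornology.IsBounded Ω) (hk : 1 ≤ k) {w z : L2 Ω} (hw : MemH k w) (hz : MemH k z)
    (c : ℝ) :
    ∀ᵐ x ∂volume.restrict Ω, weakGrad (w + c • z) x = weakGrad w x + c • weakGrad z x := by
  have h1 : ∀ i : Fin d, ∀ᵐ x ∂volume.restrict Ω,
      weakDeriv (Pi.single i 1) (w + c • z) x =
        weakDeriv (Pi.single i 1) w x + c * weakDeriv (Pi.single i 1) z x := by
    intro i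
    have hi := single_mem_multiIndices hk i
    rw [((hw.hasWeakDeriv hi).add ((hz.hasWeakDeriv hi).const_smul c)).weakDeriv_eq hΩ hΩb]
    filter_upwards [Lp.coeFn_add (weakDeriv (Pi.single i 1) w) (c • weakDeriv (Pi.single i 1) z),
      Lp.coeFn_smul c (weakDeriv (Pi.single i 1) z)] with x h1 h2
    rw [h1, Pi.add_apply, h2, Pi.smul_apply, smul_eq_mul]
  filter_upwards [ae_all_iff.mpr h1] with x hx
  ext i
  simp [weakGrad, hx i]

theorem integral_inner_weakGrad {d : ℕ} {Ω : Set (Eucl d)} (w z : L2 Ω) :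
    Integrable (fun x => inner ℝ (weakGrad w x) (weakGrad z x)) (volume.restrict Ω) ∧
    ∫ x in Ω, inner ℝ (weakGrad w x) (weakGrad z x) =
      ∑ i, inner ℝ (weakDeriv (Pi.single i 1) w) (weakDeriv (Pi.single i 1) z) := by
  have h : ∀ x, inner ℝ (weakGrad w x) (weakGrad z x) =
      ∑ i, inner ℝ (weakDeriv (Pi.single i 1) w x) (weakDeriv (Pi.single i 1) z x) := fun x => by
    rw [PiLp.inner_apply]; rfl
  simp_rw [h]
  have hi : ∀ i ∈ (Finset.univ : Finset (Fin d)), Integrable (fun x =>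
      inner ℝ (weakDeriv (Pi.single i 1) w x) (weakDeriv (Pi.single i 1) z x))
        (volume.restrict Ω) := fun i _ => L2.integrable_inner _ _
  exact ⟨integrable_finsetSum _ hi, by
    rw [integral_finsetSum _ hi]; exact Finset.sum_congr rfl fun i _ => (L2.inner_def _ _).symm⟩

/-- The `L²` norm of the weak gradient. -/
noncomputable def gradNorm {d : ℕ} {Ω : Set (Eucl d)} (w : L2 Ω) : ℝ :=
  √(∑ i, ‖weakDeriv (Pi.single i 1) w‖ ^ 2)

theorem integral_inner_weakGrad_self {d : ℕ} {Ω : Set (Eucl d)} (w : L2 Ω) :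
    ∫ x in Ω, inner ℝ (weakGrad w x) (weakGrad w x) = gradNorm w ^ 2 := by
  rw [(integral_inner_weakGrad w w).2, gradNorm, Real.sq_sqrt (by positivity)]
  exact Finset.sum_congr rfl fun i _ => real_inner_self_eq_norm_sq _

theorem abs_integral_inner_weakGrad_le {d : ℕ} {Ω : Set (Eucl d)} (w z : L2 Ω) :
    |∫ x in Ω, inner ℝ (weakGrad w x) (weakGrad z x)| ≤ gradNorm w * gradNorm z := by
  rw [(integral_inner_weakGrad w z).2]
  have h := abs_real_inner_le_norm
    (WithLp.toLp 2 fun i : Fin d => weakDeriv (Pi.single i 1) w : PiLp 2 fun _ : Fin d => L2 Ω)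
    (WithLp.toLp 2 fun i : Fin d => weakDeriv (Pi.single i 1) z)
  rwa [PiLp.inner_apply, PiLp.norm_eq_of_L2, PiLp.norm_eq_of_L2] at h

theorem gradNorm_le {d k : ℕ} {Ω : Set (Eucl d)} (hk : 1 ≤ k) (w : L2 Ω) :
    gradNorm w ≤ √d * sobolevNorm k w := by
  rw [gradNorm]
  refine Real.sqrt_le_iff.mpr ⟨mul_nonneg (Real.sqrt_nonneg _) (sobolevNorm_nonneg w), ?_⟩
  rw [mul_pow, Real.sq_sqrt (Nat.cast_nonneg d)]
  calc _ ≤ ∑ _i : Fin d, sobolevNorm k w ^ 2 := Finset.sum_le_sum fun i _ =>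
        pow_le_pow_left₀ (norm_nonneg _)
          (norm_weakDeriv_le_sobolevNorm (single_mem_multiIndices hk i) w) 2
    _ = _ := by simp

/-- Functions in `H^k(Ω)` have essentially bounded gradients. -/
theorem EmbedsInLinfty.exists_norm_weakGrad_le {d k : ℕ} {Ω : Set (Eucl d)} (hΩ : IsOpen Ω)
    (hΩb : Bornology.IsBounded Ω) (hk : 1 ≤ k) (hemb : EmbedsInLinfty Ω (k - 1)) :
    ∃ K : ℝ, 0 ≤ K ∧ ∀ w : L2 Ω, MemH k w →
      ∀ᵐ x ∂volume.restrict Ω, ‖weakGrad w x‖ ≤ K * sobolevNorm k w := by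
  obtain ⟨K, hK⟩ := hemb
  -- The embedding constant carries no sign, hence `|K|`; `√d` collects the `d` components of the
  -- gradient.
  refine ⟨|K| * √d, by positivity, fun w hw => ?_⟩
  filter_upwards [hK (fun i => weakDeriv (Pi.single i 1) w) fun i => hw.weakDeriv_single hk i]
    with x hx
  refine hx.trans ?_
  rw [mul_assoc]
  refine mul_le_mul (le_abs_self K) ?_ (Real.sqrt_nonneg _) (abs_nonneg K)
  refine Real.sqrt_le_iff.mpr ⟨mul_nonneg (Real.sqrt_nonneg _) (sobolevNorm_nonneg w), ?_⟩
  rw [mul_pow, Real.sq_sqrt (Nat.cast_nonneg d)]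
  calc _ ≤ ∑ _i : Fin d, sobolevNorm k w ^ 2 := Finset.sum_le_sum fun i _ =>
        pow_le_pow_left₀ (sobolevNorm_nonneg _)
          (hw.sobolevNorm_weakDeriv_single_le hΩ hΩb hk i) 2
    _ = _ := by simp

end Elastodynamics

namespace Elastodynamics

/-! ### `N`-functions and their conjugates -/

/-- The origin is the midpoint of `ξ` and `-ξ`, where `φ` takes equal values. -/
theorem IsNFunction.nonneg {d : ℕ} {φ : Eucl d → ℝ} (hφ : IsNFunction φ) (ξ : Eucl d) :
    0 ≤ φ ξ := by
  obtain ⟨-, hc⟩ := hφ.convex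
  have h := hc (Set.mem_univ ξ) (Set.mem_univ (-ξ)) (a := 1 / 2) (b := 1 / 2)
    (by norm_num) (by norm_num) (by norm_num)
  rw [smul_neg, add_neg_cancel, (hφ.eq_zero_iff 0).2 rfl, hφ.even, smul_eq_mul] at h
  linarith

theorem IsNFunction.exists_mul_norm_le {d : ℕ} {φ : Eucl d → ℝ} (hφ : IsNFunction φ) (L : ℝ) :
    ∃ R : ℝ, 0 ≤ R ∧ ∀ ξ : Eucl d, R ≤ ‖ξ‖ → L * ‖ξ‖ ≤ φ ξ := by
  obtain ⟨R, -, hR⟩ := (hasBasis_cobounded_norm (E := Eucl d)).eventually_iff.mp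
    (hφ.superlinear.eventually_ge_atTop L)
  refine ⟨max R 0, le_max_right _ _, fun ξ hξ => ?_⟩
  rcases eq_or_ne ξ 0 with rfl | h0
  · simpa using hφ.nonneg 0
  · exact (le_div_iff₀ (norm_pos_iff.mpr h0)).mp (hR ((le_max_left _ _).trans hξ))

/-- Outside the ball of radius `R` the growth of `φ` absorbs the pairing; inside, Cauchy-Schwarz and
`φ ≥ 0` suffice. -/
theorem IsNFunction.inner_sub_le {d : ℕ} {φ : Eucl d → ℝ} (hφ : IsNFunction φ) {L R : ℝ}
    (hR : ∀ ξ : Eucl d, R ≤ ‖ξ‖ → L * ‖ξ‖ ≤ φ ξ) (hR0 : 0 ≤ R) {η : Eucl d} (hη : ‖η‖ ≤ L)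
    (ξ : Eucl d) : inner ℝ ξ η - φ ξ ≤ R * ‖η‖ := by
  have h1 := real_inner_le_norm ξ η
  rcases le_total R ‖ξ‖ with h | h
  · have h2 := hR ξ h
    have h3 : ‖ξ‖ * ‖η‖ ≤ L * ‖ξ‖ := by
      rw [mul_comm]; exact mul_le_mul_of_nonneg_right hη (norm_nonneg ξ)
    have h4 : 0 ≤ R * ‖η‖ := by positivity
    linarith
  · have h2 := hφ.nonneg ξ
    have h3 : ‖ξ‖ * ‖η‖ ≤ R * ‖η‖ := mul_le_mul_of_nonneg_right h (norm_nonneg η)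
    linarith

/-- Young's inequality. -/
theorem IsNFunction.inner_le {d : ℕ} {φ : Eucl d → ℝ} (hφ : IsNFunction φ) (ξ η : Eucl d) :
    inner ℝ ξ η ≤ conjugate φ η + φ ξ := by
  obtain ⟨R, hR0, hR⟩ := hφ.exists_mul_norm_le ‖η‖
  -- A real supremum over an unbounded set is `0` by default, so boundedness has to be shown.
  have h : BddAbove (Set.range fun ξ : Eucl d => inner ℝ ξ η - φ ξ) :=
    ⟨R * ‖η‖, Set.forall_mem_range.mpr (hφ.inner_sub_le hR hR0 le_rfl)⟩
  exact sub_le_iff_le_add.mp (le_ciSup h ξ)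

theorem IsNFunction.exists_conjugate_le {d : ℕ} {φ : Eucl d → ℝ} (hφ : IsNFunction φ) :
    ∃ R : ℝ, 0 ≤ R ∧ ∀ η : Eucl d, ‖η‖ ≤ 1 → conjugate φ η ≤ R * ‖η‖ := by
  obtain ⟨R, hR0, hR⟩ := hφ.exists_mul_norm_le 1
  exact ⟨R, hR0, fun η hη => ciSup_le (hφ.inner_sub_le hR hR0 hη)⟩

/-- On the segment from `ξ` to `ζ`, the derivative at `0` of a convex function is at most its slope
over `[0, 1]`. -/
theorem add_inner_gradient_le_of_convexOn {d : ℕ} {φ : Eucl d → ℝ} (hφ : ConvexOn ℝ Set.univ φ)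
    {ξ g : Eucl d} (hg : HasGradientAt φ g ξ) (ζ : Eucl d) :
    φ ξ + inner ℝ g (ζ - ξ) ≤ φ ζ := by
  have hc : ConvexOn ℝ Set.univ (fun t : ℝ => φ (AffineMap.lineMap ξ ζ t)) :=
    hφ.comp_affineMap (AffineMap.lineMap ξ ζ)
  have hd : HasDerivAt (fun t : ℝ => φ (AffineMap.lineMap ξ ζ t)) (inner ℝ g (ζ - ξ)) 0 := by
    have h1 : HasDerivAt (fun t : ℝ => AffineMap.lineMap ξ ζ t) (ζ - ξ) (0 : ℝ) :=
      AffineMap.hasDerivAt_lineMap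
    have h2 : HasFDerivAt φ (InnerProductSpace.toDual ℝ (Eucl d) g)
        (AffineMap.lineMap ξ ζ (0 : ℝ)) := by
      rw [AffineMap.lineMap_apply_zero]; exact hg
    exact h2.comp_hasDerivAt (0 : ℝ) h1
  have h := hc.le_slope_of_hasDerivAt (Set.mem_univ 0) (Set.mem_univ 1) one_pos hd
  simp only [slope_def_field, AffineMap.lineMap_apply_one, AffineMap.lineMap_apply_zero, sub_zero,
    div_one] at h
  linarith

/-! ### Luxemburg norms -/

theorem luxemburgNorm_nonneg {d : ℕ} (φ : Eucl d → ℝ) (Ω : Set (Eucl d)) (η : Eucl d → Eucl d) :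
    0 ≤ luxemburgNorm φ Ω η :=
  Real.sInf_nonneg fun _ h => h.1.le

/-- The infimum of an empty set of reals is `0`, so upper bounds by the Luxemburg norm require an
admissible `lam`. -/
theorem IsNFunction.luxemburg_conjugate_nonempty {d : ℕ} {φ : Eucl d → ℝ} (hφ : IsNFunction φ)
    {Ω : Set (Eucl d)} (hΩb : Bornology.IsBounded Ω) {η : Eucl d → Eucl d} {L : ℝ}
    (hη : ∀ᵐ x ∂volume.restrict Ω, ‖η x‖ ≤ L) :
    {lam : ℝ | 0 < lam ∧
      ∫⁻ x in Ω, ENNReal.ofReal (conjugate φ (lam⁻¹ • η x)) ≤ 1}.Nonempty := by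
  obtain ⟨R, hR0, hR⟩ := hφ.exists_conjugate_le
  set V := (volume Ω).toReal
  have hV0 : 0 ≤ V := ENNReal.toReal_nonneg
  have hV : volume Ω = ENNReal.ofReal V := (ENNReal.ofReal_toReal hΩb.measure_lt_top.ne).symm
  set M := max L 0
  have hM0 : 0 ≤ M := le_max_right _ _
  have hRMV : 0 ≤ R * M * V := by positivity
  -- Large enough that both `M / lam ≤ 1`, where the linear bound on the conjugate is valid, and `R
  -- * M * V / lam ≤ 1`.
  set lam := M + R * M * V + 1
  have hlam : 0 < lam := by positivity
  refine ⟨lam, hlam, ?_⟩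
  calc ∫⁻ x in Ω, ENNReal.ofReal (conjugate φ (lam⁻¹ • η x))
      ≤ ∫⁻ _ in Ω, ENNReal.ofReal (R * (M / lam)) := by
        refine lintegral_mono_ae ?_
        filter_upwards [hη] with x hx
        have h1 : ‖lam⁻¹ • η x‖ ≤ M / lam := by
          rw [norm_smul, Real.norm_of_nonneg (inv_nonneg.mpr hlam.le), div_eq_inv_mul]
          exact mul_le_mul_of_nonneg_left (hx.trans (le_max_left _ _)) (inv_nonneg.mpr hlam.le)
        have h2 : M / lam ≤ 1 := (div_le_one hlam).mpr (by simp only [lam]; linarith)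
        exact ENNReal.ofReal_le_ofReal
          ((hR _ (h1.trans h2)).trans (mul_le_mul_of_nonneg_left h1 hR0))
    _ = ENNReal.ofReal (R * (M / lam) * V) := by
        rw [setLIntegral_const, hV,
          ENNReal.ofReal_mul (p := R * (M / lam)) (by positivity)]
    _ ≤ 1 := by
        rw [ENNReal.ofReal_le_one]
        have : R * (M / lam) * V = R * M * V / lam := by ring
        rw [this, div_le_one hlam]
        simp only [lam]
        linarith

/-- A Hölder inequality: apply Young to `ξ / s` and `η / lam` for each admissible `lam`, integrate,
and take the infimum over `lam`. The bound of `φ` on a ball replaces a Luxemburg norm of `ξ`. -/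
theorem IsNFunction.integral_inner_le_luxemburgNorm {d : ℕ} {φ : Eucl d → ℝ} (hφ : IsNFunction φ)
    {Ω : Set (Eucl d)} (hΩb : Bornology.IsBounded Ω) {R M : ℝ} (hM0 : 0 ≤ M)
    (hM : ∀ ζ : Eucl d, ‖ζ‖ ≤ R → φ ζ ≤ M) {η ξ : Eucl d → Eucl d} {L s : ℝ} (hs : 0 ≤ s)
    (hη : ∀ᵐ x ∂volume.restrict Ω, ‖η x‖ ≤ L) (hξ : ∀ᵐ x ∂volume.restrict Ω, ‖ξ x‖ ≤ R * s)
    (hint : Integrable (fun x => inner ℝ (η x) (ξ x)) (volume.restrict Ω)) :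
    ∫ x in Ω, inner ℝ (η x) (ξ x) ≤
      (1 + M * (volume Ω).toReal) * luxemburgNorm (conjugate φ) Ω η * s := by
  rcases hs.eq_or_lt with rfl | hs
  · rw [mul_zero]
    refine (integral_eq_zero_of_ae ?_).le
    filter_upwards [hξ] with x hx
    rw [mul_zero, norm_le_zero_iff] at hx
    simp [hx]
  set V := (volume Ω).toReal
  have hV0 : 0 ≤ V := ENNReal.toReal_nonneg
  have hV : volume Ω = ENNReal.ofReal V := (ENNReal.ofReal_toReal hΩb.measure_lt_top.ne).symm
  have hB : 0 < (1 + M * V) * s := by positivity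
  have key : (∫ x in Ω, inner ℝ (η x) (ξ x)) / ((1 + M * V) * s) ≤
      luxemburgNorm (conjugate φ) Ω η := by
    refine le_csInf (hφ.luxemburg_conjugate_nonempty hΩb hη) ?_
    rintro lam ⟨hlam, hle⟩
    have hscale : ∀ x, inner ℝ (s⁻¹ • ξ x) (lam⁻¹ • η x) =
        (s⁻¹ * lam⁻¹) * inner ℝ (η x) (ξ x) := fun x => by
      rw [real_inner_smul_left, real_inner_smul_right, real_inner_comm, mul_assoc]
    have hlint : ∫⁻ x in Ω, ENNReal.ofReal (inner ℝ (s⁻¹ • ξ x) (lam⁻¹ • η x)) ≤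
        ENNReal.ofReal (1 + M * V) := by
      calc _ ≤ ∫⁻ x in Ω, (ENNReal.ofReal (conjugate φ (lam⁻¹ • η x)) + ENNReal.ofReal M) := by
            refine lintegral_mono_ae ?_
            filter_upwards [hξ] with x hx
            refine (ENNReal.ofReal_le_ofReal ?_).trans ENNReal.ofReal_add_le
            refine (hφ.inner_le _ _).trans (add_le_add le_rfl (hM _ ?_))
            rw [norm_smul, Real.norm_of_nonneg (inv_nonneg.mpr hs.le), inv_mul_le_iff₀ hs, mul_comm]
            exact hx
        _ ≤ 1 + ENNReal.ofReal (M * V) := by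
            rw [lintegral_add_right _ measurable_const, setLIntegral_const, hV,
              ENNReal.ofReal_mul hM0]
            exact add_le_add hle le_rfl
        _ = ENNReal.ofReal (1 + M * V) := by
            rw [ENNReal.ofReal_add zero_le_one (by positivity), ENNReal.ofReal_one]
    have hle' : ∫ x in Ω, inner ℝ (s⁻¹ • ξ x) (lam⁻¹ • η x) ≤ 1 + M * V := by
      -- Only the positive part is controlled by `hlint`; the negative part is dropped.
      rw [integral_eq_lintegral_pos_part_sub_lintegral_neg_part (by
        simp_rw [hscale]; exact hint.const_mul _)]
      refine (sub_le_self _ ENNReal.toReal_nonneg).trans ?_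
      exact ENNReal.toReal_le_of_le_ofReal (by positivity) hlint
    simp_rw [hscale] at hle'
    rw [integral_const_mul, ← mul_inv, inv_mul_le_iff₀ (by positivity)] at hle'
    rw [div_le_iff₀ hB]
    linarith
  rw [div_le_iff₀ hB] at key
  linarith

end Elastodynamics

namespace Elastodynamics

/-! ### The Galerkin projection -/

theorem IsEigenbasis.mem_sobolevSpace {d r : ℕ} {Ω : Set (Eucl d)}
    {e : HilbertBasis ℕ ℝ (L2 Ω)} {μ : ℕ → ℝ} (he : IsEigenbasis r e μ) (j : ℕ) :
    e j ∈ sobolevSpace Ω r := by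
  have h : μ j • e j ∈ sobolevSpace Ω r := (he.eigen j).1.1
  exact ((sobolevSpace Ω r).smul_mem_iff (he.pos j).ne').mp h

theorem IsEigenbasis.galerkinSpace_le {d r : ℕ} {Ω : Set (Eucl d)}
    {e : HilbertBasis ℕ ℝ (L2 Ω)} {μ : ℕ → ℝ} (he : IsEigenbasis r e μ) (m : ℕ) :
    galerkinSpace e μ m ≤ sobolevSpace Ω r := by
  rw [galerkinSpace, Submodule.span_le]
  rintro _ ⟨j, _, rfl⟩
  exact Submodule.smul_mem _ _ (he.mem_sobolevSpace j)

theorem IsEigenbasis.mem_galerkinSpace {d r : ℕ} {Ω : Set (Eucl d)}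
    {e : HilbertBasis ℕ ℝ (L2 Ω)} {μ : ℕ → ℝ} (he : IsEigenbasis r e μ) {m j : ℕ} (hj : j < m) :
    e j ∈ galerkinSpace e μ m := by
  have h : √(μ j) • e j ∈ galerkinSpace e μ m := Submodule.subset_span ⟨j, hj, rfl⟩
  exact (Submodule.smul_mem_iff _ (Real.sqrt_pos.mpr (he.pos j)).ne').mp h

theorem IsEigenbasis.inner_jet {d r : ℕ} {Ω : Set (Eucl d)} (hΩ : IsOpen Ω)
    (hΩb : Bornology.IsBounded Ω) {e : HilbertBasis ℕ ℝ (L2 Ω)} {μ : ℕ → ℝ}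
    (he : IsEigenbasis r e μ) (j : ℕ) {w : L2 Ω} (hw : MemHr r w) :
    inner ℝ (jet hΩ hΩb r ⟨e j, he.mem_sobolevSpace j⟩) (jet hΩ hΩb r ⟨w, hw.1⟩) =
      (μ j)⁻¹ * inner ℝ (e j) w := by
  have h := (he.eigen j).2 w hw
  have h' := sobolevInner_eq_inner_jet hΩ hΩb (k := r)
    (μ j • (⟨e j, he.mem_sobolevSpace j⟩ : sobolevSpace Ω r)) ⟨w, hw.1⟩
  rw [map_smul, real_inner_smul_left] at h'
  rw [← h]
  refine (inv_mul_eq_iff_eq_mul₀ (he.pos j).ne').mpr h' |>.symm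

theorem IsEigenbasis.inner_jet_basis {d r : ℕ} {Ω : Set (Eucl d)} (hΩ : IsOpen Ω)
    (hΩb : Bornology.IsBounded Ω) {e : HilbertBasis ℕ ℝ (L2 Ω)} {μ : ℕ → ℝ}
    (he : IsEigenbasis r e μ) (i j : ℕ) :
    inner ℝ (jet hΩ hΩb r ⟨e j, he.mem_sobolevSpace j⟩)
      (jet hΩ hΩb r ⟨e i, he.mem_sobolevSpace i⟩) = if j = i then (μ j)⁻¹ else 0 := by
  have h := he.inner_jet hΩ hΩb j (he.eigen i).1
  have h' : (⟨μ i • e i, (he.eigen i).1.1⟩ : sobolevSpace Ω r) =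
      μ i • ⟨e i, he.mem_sobolevSpace i⟩ := rfl
  rw [h', map_smul, real_inner_smul_right, real_inner_smul_right, mul_left_comm] at h
  rw [mul_left_cancel₀ (he.pos i).ne' h, orthonormal_iff_ite.mp e.orthonormal, mul_ite, mul_one,
    mul_zero]

/-- With `p = ∑_{j<m} (e j, w) e j`, both `(p, w)_r` and `(p, p)_r` equal `∑ (e j, w)² / μ j`. Thus
`‖p‖_r² = (p, w)_r`, and Cauchy-Schwarz gives contractivity. -/
theorem IsEigenbasis.exists_projection {d r : ℕ} {Ω : Set (Eucl d)} (hΩ : IsOpen Ω)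
    (hΩb : Bornology.IsBounded Ω) {e : HilbertBasis ℕ ℝ (L2 Ω)} {μ : ℕ → ℝ}
    (he : IsEigenbasis r e μ) (m : ℕ) {w : L2 Ω} (hw : MemHr r w) :
    ∃ p ∈ galerkinSpace e μ m, sobolevNorm r p ≤ sobolevNorm r w ∧
      ∀ z ∈ galerkinSpace e μ m, inner ℝ z w = inner ℝ z p := by
  set c : ℕ → ℝ := fun j => inner ℝ (e j) w
  set E : ℕ → sobolevSpace Ω r := fun j => ⟨e j, he.mem_sobolevSpace j⟩
  set J := jet hΩ hΩb r
  set P : sobolevSpace Ω r := ∑ j ∈ Finset.range m, c j • E j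
  have hP : (P : L2 Ω) = ∑ j ∈ Finset.range m, c j • e j := by
    simp [P, E]
  refine ⟨P, ?_, ?_, ?_⟩
  · rw [hP]
    exact Submodule.sum_mem _ fun j hj =>
      Submodule.smul_mem _ _ (he.mem_galerkinSpace (Finset.mem_range.mp hj))
  · have hJP : J P = ∑ j ∈ Finset.range m, c j • J (E j) := by simp [P]
    have h1 : inner ℝ (J P) (J ⟨w, hw.1⟩) = ∑ j ∈ Finset.range m, c j * ((μ j)⁻¹ * c j) := by
      rw [hJP, sum_inner]
      refine Finset.sum_congr rfl fun j _ => ?_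
      rw [real_inner_smul_left, he.inner_jet hΩ hΩb j hw]
    have h2 : inner ℝ (J P) (J P) = ∑ j ∈ Finset.range m, c j * ((μ j)⁻¹ * c j) := by
      rw [hJP, sum_inner]
      refine Finset.sum_congr rfl fun j hj => ?_
      rw [real_inner_smul_left, inner_sum]
      congr 1
      simp_rw [real_inner_smul_right]
      rw [Finset.sum_congr rfl fun i _ => by rw [he.inner_jet_basis hΩ hΩb i j]]
      simp only [mul_ite, mul_zero, Finset.sum_ite_eq, hj, if_true]
      exact mul_comm _ _
    have h3 : ‖J P‖ * ‖J P‖ ≤ ‖J P‖ * ‖J ⟨w, hw.1⟩‖ := by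
      rw [← real_inner_self_eq_norm_mul_norm, h2, ← h1]
      exact real_inner_le_norm _ _
    rw [sobolevNorm_eq_norm_jet hΩ hΩb P, show sobolevNorm r w = ‖J ⟨w, hw.1⟩‖ from
      sobolevNorm_eq_norm_jet hΩ hΩb ⟨w, hw.1⟩]
    rcases (norm_nonneg (J P)).eq_or_lt with h | h
    · rw [show ‖jet hΩ hΩb r P‖ = 0 from h.symm]
      exact norm_nonneg _
    · exact le_of_mul_le_mul_left h3 h
  · intro z hz
    rw [galerkinSpace] at hz
    induction hz using Submodule.span_induction with
    | mem z hz =>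
      obtain ⟨j, hj, rfl⟩ := hz
      rw [real_inner_smul_left, real_inner_smul_left, hP, inner_sum]
      congr 1
      simp_rw [real_inner_smul_right, orthonormal_iff_ite.mp e.orthonormal, mul_ite, mul_one,
        mul_zero]
      rw [Finset.sum_ite_eq, if_pos (Finset.mem_range.mpr hj)]
    | zero => simp
    | add x y _ _ hx hy => rw [inner_add_left, inner_add_left, hx, hy]
    | smul a x _ hx => rw [real_inner_smul_left, real_inner_smul_left, hx]

theorem IsEigenbasis.dualNorm_le {d r : ℕ} {Ω : Set (Eucl d)} (hΩ : IsOpen Ω)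
    (hΩb : Bornology.IsBounded Ω) {e : HilbertBasis ℕ ℝ (L2 Ω)} {μ : ℕ → ℝ}
    (he : IsEigenbasis r e μ) (m : ℕ) {z : L2 Ω} (hz : z ∈ galerkinSpace e μ m) {A : ℝ}
    (hA : 0 ≤ A) (h : ∀ ψ ∈ galerkinSpace e μ m, |inner ℝ z ψ| ≤ A * sobolevNorm r ψ) :
    dualNorm r z ≤ A := by
  refine Real.sSup_le ?_ hA
  rintro _ ⟨w, hw, -, rfl⟩
  obtain ⟨p, hp, hpw, hpz⟩ := he.exists_projection hΩ hΩb m hw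
  rw [hpz z hz]
  exact div_le_of_le_mul₀ (sobolevNorm_nonneg w) hA
    ((h p hp).trans (mul_le_mul_of_nonneg_left hpw hA))

/-! ### The energy estimate -/

/-- The accumulated energy satisfies `y (k+1) ≤ y k + 2 F (k+1) √(y (k+1))`, so `√y` grows by at
most `2 F (k+1)` per step. Working with the root keeps the bound linear in the data, without an
exponential factor. -/
theorem sum_le_sq_of_energy_inequality {N : ℕ} {a g E F : ℕ → ℝ} {τ : ℝ} (hτ : 0 ≤ τ)
    (hg : ∀ n, 0 ≤ g n) (hE : ∀ n, 0 ≤ E n) (ha : ∀ n, 0 ≤ a n)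
    (hF : ∀ n, 0 ≤ F n)
    (h : ∀ n ∈ Finset.Icc 1 N,
      a n ^ 2 - a (n - 1) ^ 2 + 2 * (τ * g n) + 2 * (E n - E (n - 1)) ≤ 2 * (F n * a n)) :
    2 * (τ * ∑ n ∈ Finset.Icc 1 N, g n) ≤
      (a 0 + √(2 * E 0) + 2 * ∑ n ∈ Finset.Icc 1 N, F n) ^ 2 := by
  set y : ℕ → ℝ := fun k => a k ^ 2 + 2 * E k + 2 * (τ * ∑ n ∈ Finset.Icc 1 k, g n) with hy
  have hG : ∀ k, 0 ≤ τ * ∑ n ∈ Finset.Icc 1 k, g n := fun k =>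
    mul_nonneg hτ (Finset.sum_nonneg fun n _ => hg n)
  have hy0 : ∀ k, 0 ≤ y k := fun k => by
    have := hG k; have := hE k; have := sq_nonneg (a k); simp only [hy]; linarith
  have hay : ∀ k, a k ≤ √(y k) := fun k => Real.le_sqrt_of_sq_le (by
    have := hG k; have := hE k; simp only [hy]; linarith)
  have key : ∀ k ≤ N, √(y k) ≤ √(y 0) + 2 * ∑ n ∈ Finset.Icc 1 k, F n := by
    intro k
    induction k with
    | zero => intro _; simp
    | succ k ih =>
      intro hk
      have ih := ih (by omega)
      have hstep := h (k + 1) (Finset.mem_Icc.mpr ⟨by omega, hk⟩)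
      rw [Nat.add_sub_cancel] at hstep
      have hsq : √(y (k + 1)) ^ 2 ≤ √(y k) ^ 2 + 2 * (F (k + 1) * √(y (k + 1))) := by
        rw [Real.sq_sqrt (hy0 _), Real.sq_sqrt (hy0 _)]
        have := mul_le_mul_of_nonneg_left (hay (k + 1)) (hF (k + 1))
        have hdiff : y (k + 1) - y k = a (k + 1) ^ 2 - a k ^ 2 + 2 * (τ * g (k + 1)) +
            2 * (E (k + 1) - E k) := by
          simp only [hy]
          rw [Finset.sum_Icc_succ_top (by omega)]
          ring
        linarith
      have hle : √(y (k + 1)) ≤ √(y k) + 2 * F (k + 1) := by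
        by_contra! hlt
        have := hF (k + 1)
        nlinarith [Real.sqrt_nonneg (y k), Real.sqrt_nonneg (y (k + 1))]
      rw [Finset.sum_Icc_succ_top (by omega)]
      linarith
  have h0 : √(y 0) ≤ a 0 + √(2 * E 0) := by
    have : y 0 = a 0 ^ 2 + 2 * E 0 := by simp [hy]
    rw [this]
    refine Real.sqrt_le_iff.mpr ⟨add_nonneg (ha 0) (Real.sqrt_nonneg _), ?_⟩
    have h2 := mul_nonneg (ha 0) (Real.sqrt_nonneg (2 * E 0))
    rw [add_sq, Real.sq_sqrt (by linarith [hE 0])]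
    linarith
  have hN := (key N le_rfl).trans (add_le_add_left h0 _)
  calc 2 * (τ * ∑ n ∈ Finset.Icc 1 N, g n) ≤ y N := by
        have := hE N; have := sq_nonneg (a N); simp only [hy]; linarith
    _ = √(y N) ^ 2 := (Real.sq_sqrt (hy0 N)).symm
    _ ≤ _ := pow_le_pow_left₀ (Real.sqrt_nonneg _) hN 2

/-- Gradients of Galerkin functions are essentially bounded, so continuity alone makes the nonlinear
terms integrable; no upper growth condition is needed. -/
theorem exists_norm_comp_le {d : ℕ} {F : Type*} [NormedAddCommGroup F] {Ω : Set (Eucl d)}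
    {σ : Eucl d → F} (hσ : Continuous σ) {ξ : Eucl d → Eucl d} {L : ℝ}
    (hξ : ∀ᵐ x ∂volume.restrict Ω, ‖ξ x‖ ≤ L) :
    ∃ L', ∀ᵐ x ∂volume.restrict Ω, ‖σ (ξ x)‖ ≤ L' := by
  obtain ⟨L', h⟩ := (isCompact_closedBall (0 : Eucl d) L).exists_bound_of_continuousOn
    hσ.continuousOn
  refine ⟨L', ?_⟩
  filter_upwards [hξ] with x hx
  exact h _ (mem_closedBall_zero_iff.mpr hx)

theorem integrable_comp_weakGrad {d : ℕ} {Ω : Set (Eucl d)} (hΩb : Bornology.IsBounded Ω)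
    {φ : Eucl d → ℝ} (hφ : Continuous φ) {w : L2 Ω} {L : ℝ}
    (hw : ∀ᵐ x ∂volume.restrict Ω, ‖weakGrad w x‖ ≤ L) :
    Integrable (fun x => φ (weakGrad w x)) (volume.restrict Ω) := by
  have := isFiniteMeasure_restrict hΩb
  obtain ⟨L', h⟩ := exists_norm_comp_le hφ hw
  exact .of_bound (hφ.comp_aestronglyMeasurable (aestronglyMeasurable_weakGrad w)) L' h

theorem integrable_stress {d : ℕ} {Ω : Set (Eucl d)} (hΩb : Bornology.IsBounded Ω)
    {σ : Eucl d → Eucl d} (hσ : Continuous σ) {w z : L2 Ω} {L L' : ℝ}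
    (hw : ∀ᵐ x ∂volume.restrict Ω, ‖weakGrad w x‖ ≤ L)
    (hz : ∀ᵐ x ∂volume.restrict Ω, ‖weakGrad z x‖ ≤ L') :
    Integrable (fun x => inner ℝ (σ (weakGrad w x)) (weakGrad z x)) (volume.restrict Ω) := by
  have := isFiniteMeasure_restrict hΩb
  obtain ⟨M, h⟩ := exists_norm_comp_le hσ hw
  refine .of_bound ((hσ.comp_aestronglyMeasurable (aestronglyMeasurable_weakGrad w)).inner
    (aestronglyMeasurable_weakGrad z)) (M * L') ?_
  filter_upwards [h, hz] with x h1 h2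
  exact (norm_inner_le_norm _ _).trans
    (mul_le_mul h1 h2 (norm_nonneg _) ((norm_nonneg _).trans h1))

theorem IsDiscreteSolution.weak_form {d : ℕ} {Ω : Set (Eucl d)} {σ : Eucl d → Eucl d} {τ : ℝ}
    {N : ℕ} {W : Submodule ℝ (L2 Ω)} {f : ℝ → L2 Ω} {u v : ℕ → L2 Ω}
    (h : IsDiscreteSolution σ τ N W f u v) {n : ℕ} (hn : n ∈ Finset.Icc 1 N) {ψ : L2 Ω}
    (hψ : ψ ∈ W)
    (hint : Integrable (fun x => inner ℝ (σ (weakGrad (u n) x)) (weakGrad ψ x))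
      (volume.restrict Ω)) :
    inner ℝ (τ⁻¹ • (v n - v (n - 1))) ψ +
        (∫ x in Ω, inner ℝ (weakGrad (v n) x) (weakGrad ψ x)) +
        ∫ x in Ω, inner ℝ (σ (weakGrad (u n) x)) (weakGrad ψ x) =
      inner ℝ (timeAverage τ f n) ψ := by
  have key := h.momentum n hn ψ hψ
  have h1 : Integrable (fun x => (τ⁻¹ • (v n - v (n - 1))) x * ψ x) (volume.restrict Ω) :=
    (L2.integrable_inner (𝕜 := ℝ) (τ⁻¹ • (v n - v (n - 1))) ψ).congr
      (.of_forall fun x => by simp [mul_comm])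
  have h2 := (integral_inner_weakGrad (v n) ψ).1
  have hadd := integral_add (h1.add h2) hint
  simp only [Pi.add_apply] at hadd
  rw [hadd, integral_add h1 h2, integral_mul_eq_inner,
    integral_mul_eq_inner] at key
  exact key

/-- Test with `v n`. As `∇u^{n-1} = ∇u^n - τ ∇v^n`, the tangent inequality for `φ` at the implicit
value `∇u^n` bounds the energy increment by the stress power. -/
theorem IsDiscreteSolution.energy_inequality {d r : ℕ} {Ω : Set (Eucl d)} (hΩ : IsOpen Ω)
    (hΩb : Bornology.IsBounded Ω) (hr : 1 ≤ r) {φ : Eucl d → ℝ} (hφ : IsNFunction φ)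
    {σ : Eucl d → Eucl d} (hσc : Continuous σ) (hσ : ∀ ξ, HasGradientAt φ (σ ξ) ξ) {τ : ℝ}
    (hτ : 0 < τ) {N : ℕ} {W : Submodule ℝ (L2 Ω)} (hW : W ≤ sobolevSpace Ω r) {K : ℝ}
    (hK : ∀ w : L2 Ω, MemH r w →
      ∀ᵐ x ∂volume.restrict Ω, ‖weakGrad w x‖ ≤ K * sobolevNorm r w)
    {f : ℝ → L2 Ω} {u v : ℕ → L2 Ω} (h : IsDiscreteSolution σ τ N W f u v) {n : ℕ}
    (hn : n ∈ Finset.Icc 1 N) :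
    ‖v n‖ ^ 2 - ‖v (n - 1)‖ ^ 2 + 2 * (τ * gradNorm (v n) ^ 2) +
        2 * ((∫ x in Ω, φ (weakGrad (u n) x)) - ∫ x in Ω, φ (weakGrad (u (n - 1)) x)) ≤
      2 * (τ * ‖timeAverage τ f n‖ * ‖v n‖) := by
  have hn' := Finset.mem_Icc.mp hn
  have hv := h.mem_v n hn'.2
  have hu := h.mem_u n hn'.2
  have hu' := h.mem_u (n - 1) (by omega)
  have hi1 := integrable_stress hΩb hσc (hK _ (hW hu)) (hK _ (hW hv))
  have hiu := integrable_comp_weakGrad hΩb hφ.continuous (hK _ (hW hu))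
  have hiu' := integrable_comp_weakGrad hΩb hφ.continuous (hK _ (hW hu'))
  have hvel : u n = u (n - 1) + τ • v n := by
    rw [← h.velocity n hn, smul_inv_smul₀ hτ.ne', add_sub_cancel]
  have hstress : (∫ x in Ω, φ (weakGrad (u n) x)) - ∫ x in Ω, φ (weakGrad (u (n - 1)) x) ≤
      τ * ∫ x in Ω, inner ℝ (σ (weakGrad (u n) x)) (weakGrad (v n) x) := by
    rw [← integral_sub hiu hiu', ← integral_const_mul]
    refine integral_mono_ae (hiu.sub hiu') (hi1.const_mul τ) ?_
    have hgrad := weakGrad_add_smul hΩ hΩb hr (hW hu') (hW hv) τ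
    rw [← hvel] at hgrad
    filter_upwards [hgrad] with x hx
    have := add_inner_gradient_le_of_convexOn hφ.convex (hσ (weakGrad (u n) x))
      (weakGrad (u (n - 1)) x)
    have hd : weakGrad (u (n - 1)) x - weakGrad (u n) x = -(τ • weakGrad (v n) x) := by
      rw [hx]; abel
    rw [hd, inner_neg_right, real_inner_smul_right] at this
    linarith
  have hweak := h.weak_form hn hv hi1
  rw [integral_inner_weakGrad_self, real_inner_smul_left, inner_sub_left,
    real_inner_self_eq_norm_sq] at hweak
  have hf := real_inner_le_norm (timeAverage τ f n) (v n)
  have hvv := real_inner_le_norm (v (n - 1)) (v n)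
  have hw2 : ‖v n‖ ^ 2 - inner ℝ (v (n - 1)) (v n) + τ * gradNorm (v n) ^ 2 +
      τ * ∫ x in Ω, inner ℝ (σ (weakGrad (u n) x)) (weakGrad (v n) x) =
      τ * inner ℝ (timeAverage τ f n) (v n) := by
    rw [← hweak]
    field_simp
  have hf' := mul_le_mul_of_nonneg_left hf hτ.le
  -- The square gives `2 ‖v^{n-1}‖ ‖v^n‖ ≤ ‖v^{n-1}‖² + ‖v^n‖²` for the difference quotient.
  nlinarith [sq_nonneg (‖v n‖ - ‖v (n - 1)‖)]

/-! ### The time averages -/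

theorem sum_norm_timeAverage_le {d : ℕ} {Ω : Set (Eucl d)} {T : ℝ} (hT : 0 < T) {N : ℕ}
    (hN : 1 ≤ N) {f : ℝ → L2 Ω} (hf : IntegrableOn f (Set.Ioo 0 T) volume) :
    ∑ n ∈ Finset.Icc 1 N, T / N * ‖timeAverage (T / N) f n‖ ≤ ∫ t in Set.Ioo 0 T, ‖f t‖ := by
  have hN0 : (0 : ℝ) < N := by exact_mod_cast hN
  set τ := T / N
  have hτ : 0 < τ := div_pos hT hN0
  have hNτ : (N : ℝ) * τ = T := mul_div_cancel₀ T hN0.ne'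
  have hint : IntervalIntegrable (fun t => ‖f t‖) volume 0 T := by
    rw [intervalIntegrable_iff_integrableOn_Ioo_of_le hT.le]
    exact hf.norm
  have hpiece : ∀ k < N, IntervalIntegrable (fun t => ‖f t‖) volume ((k : ℝ) * τ)
      (((k + 1 : ℕ) : ℝ) * τ) := by
    intro k hk
    refine hint.mono_set ?_
    rw [Set.uIcc_of_le hT.le, Set.uIcc_of_le (by push_cast; nlinarith)]
    refine Set.Icc_subset_Icc (by positivity) ?_
    rw [← hNτ]
    exact mul_le_mul_of_nonneg_right (by exact_mod_cast hk) hτ.le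
  have hsum := intervalIntegral.sum_integral_adjacent_intervals hpiece
  rw [Nat.cast_zero, zero_mul, hNτ, intervalIntegral.integral_of_le hT.le,
    integral_Ioc_eq_integral_Ioo] at hsum
  have hshift : ∑ n ∈ Finset.Icc 1 N, τ * ‖timeAverage τ f n‖ =
      ∑ k ∈ Finset.range N, τ * ‖timeAverage τ f (k + 1)‖ := by
    rw [Finset.range_eq_Ico, Finset.sum_Ico_add' (fun n => τ * ‖timeAverage τ f n‖) 0 N 1]
    rfl
  rw [← hsum, hshift]
  refine Finset.sum_le_sum fun k _ => ?_
  rw [timeAverage, norm_smul, Real.norm_of_nonneg (inv_nonneg.mpr hτ.le),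
    mul_inv_cancel_left₀ hτ.ne', Nat.cast_succ, add_sub_cancel_right]
  exact intervalIntegral.norm_integral_le_integral_norm (by nlinarith)

end Elastodynamics

namespace Elastodynamics

/-! ### The estimates of the discrete time derivative -/

theorem IsDiscreteSolution.dualNorm_le {d r : ℕ} {Ω : Set (Eucl d)} (hΩ : IsOpen Ω)
    (hΩb : Bornology.IsBounded Ω) (hr : 1 ≤ r) {φ : Eucl d → ℝ} (hφ : IsNFunction φ)
    {σ : Eucl d → Eucl d} (hσc : Continuous σ) {K M : ℝ}
    (hK : ∀ w : L2 Ω, MemH r w →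
      ∀ᵐ x ∂volume.restrict Ω, ‖weakGrad w x‖ ≤ K * sobolevNorm r w) (hM0 : 0 ≤ M)
    (hM : ∀ ζ : Eucl d, ‖ζ‖ ≤ K → φ ζ ≤ M) {e : HilbertBasis ℕ ℝ (L2 Ω)} {μ : ℕ → ℝ}
    (he : IsEigenbasis r e μ) {m N : ℕ} {τ : ℝ} {f : ℝ → L2 Ω} {u v : ℕ → L2 Ω}
    (h : IsDiscreteSolution σ τ N (galerkinSpace e μ m) f u v) {n : ℕ}
    (hn : n ∈ Finset.Icc 1 N) :
    dualNorm r (τ⁻¹ • (v n - v (n - 1))) ≤ ‖timeAverage τ f n‖ + √d * gradNorm (v n) +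
      (1 + M * (volume Ω).toReal) *
        luxemburgNorm (conjugate φ) Ω (fun x => σ (weakGrad (u n) x)) := by
  have hn' := Finset.mem_Icc.mp hn
  have hW := he.galerkinSpace_le m
  have hu := h.mem_u n hn'.2
  set Λ := luxemburgNorm (conjugate φ) Ω (fun x => σ (weakGrad (u n) x))
  have hΛ : 0 ≤ Λ := luxemburgNorm_nonneg _ _ _
  have hg : 0 ≤ gradNorm (v n) := Real.sqrt_nonneg _
  have hone : ∀ ψ ∈ galerkinSpace e μ m, inner ℝ (τ⁻¹ • (v n - v (n - 1))) ψ ≤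
      (‖timeAverage τ f n‖ + √d * gradNorm (v n) + (1 + M * (volume Ω).toReal) * Λ) *
        sobolevNorm r ψ := by
    intro ψ hψ
    have hint := integrable_stress hΩb hσc (hK _ (hW hu)) (hK _ (hW hψ))
    have hweak := h.weak_form hn hψ hint
    have h1 : inner ℝ (timeAverage τ f n) ψ ≤ ‖timeAverage τ f n‖ * sobolevNorm r ψ :=
      (real_inner_le_norm _ _).trans
        (mul_le_mul_of_nonneg_left (norm_le_sobolevNorm hΩ hΩb ψ) (norm_nonneg _))
    have h2 := (neg_le_abs _).trans (abs_integral_inner_weakGrad_le (v n) ψ)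
    have h2' := mul_le_mul_of_nonneg_left (gradNorm_le hr ψ) hg
    obtain ⟨L, hL⟩ := exists_norm_comp_le hσc (hK _ (hW hu))
    have h3 := hφ.integral_inner_le_luxemburgNorm hΩb hM0 hM (sobolevNorm_nonneg ψ) hL
      -- The stress changes sign when moved to the right-hand side.
      (ξ := fun x => -weakGrad ψ x) (by simpa only [norm_neg] using hK _ (hW hψ))
      (by simp only [inner_neg_right]; exact hint.neg)
    simp only [inner_neg_right] at h3
    rw [integral_neg] at h3
    linarith
  refine he.dualNorm_le hΩ hΩb m (Submodule.smul_mem _ _ (Submodule.sub_mem _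
    (h.mem_v n hn'.2) (h.mem_v (n - 1) (by omega)))) (by positivity) fun ψ hψ => ?_
  refine abs_le'.mpr ⟨hone ψ hψ, ?_⟩
  have h1 := hone (-ψ) (Submodule.neg_mem _ hψ)
  have h2 : sobolevNorm r (-ψ) = sobolevNorm r ψ := by
    have h3 := sobolevNorm_eq_norm_jet hΩ hΩb (-(⟨ψ, hW hψ⟩ : sobolevSpace Ω r))
    rw [map_neg, norm_neg, ← sobolevNorm_eq_norm_jet] at h3
    exact h3
  rwa [inner_neg_right, h2] at h1

theorem integral_weakGrad_zero {d r : ℕ} {Ω : Set (Eucl d)} (hΩ : IsOpen Ω)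
    (hΩb : Bornology.IsBounded Ω) {φ : Eucl d → ℝ} (hφ : IsNFunction φ) {K : ℝ}
    (hK : ∀ w : L2 Ω, MemH r w →
      ∀ᵐ x ∂volume.restrict Ω, ‖weakGrad w x‖ ≤ K * sobolevNorm r w) :
    ∫ x in Ω, φ (weakGrad (0 : L2 Ω) x) = 0 := by
  have h0 : sobolevNorm r (0 : L2 Ω) = 0 := by
    have h := sobolevNorm_eq_norm_jet hΩ hΩb (0 : sobolevSpace Ω r)
    rwa [map_zero, norm_zero] at h
  refine integral_eq_zero_of_ae ?_
  filter_upwards [hK 0 (sobolevSpace Ω r).zero_mem] with x hx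
  rw [h0, mul_zero, norm_le_zero_iff] at hx
  rw [hx]
  exact (hφ.eq_zero_iff 0).2 rfl

theorem exists_sum_dualNorm_le {d r : ℕ} {Ω : Set (Eucl d)} (hΩ : IsOpen Ω)
    (hΩb : Bornology.IsBounded Ω) {T : ℝ} (hT : 0 < T) (hr : 1 ≤ r) {φ : Eucl d → ℝ}
    (hφ : IsNFunction φ) {σ : Eucl d → Eucl d} (hσc : Continuous σ)
    (hσ : ∀ ξ, HasGradientAt φ (σ ξ) ξ) (hemb : EmbedsInLinfty Ω (r - 1)) :
    ∃ C : ℝ, 0 < C ∧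
      ∀ (e : HilbertBasis ℕ ℝ (L2 Ω)) (μ : ℕ → ℝ), IsEigenbasis r e μ →
      ∀ (m N : ℕ) (hN : 1 ≤ N) (f : ℝ → L2 Ω), IntegrableOn f (Set.Ioo 0 T) volume →
      ∀ u v : ℕ → L2 Ω, IsDiscreteSolution σ (T / N) N (galerkinSpace e μ m) f u v →
        (T / N) * ∑ n ∈ Finset.Icc 1 N, dualNorm r ((T / N)⁻¹ • (v n - v (n - 1)))
          ≤ C * (‖v 0‖ + √(∫ x in Ω, φ (weakGrad (u 0) x)) + (∫ t in Set.Ioo 0 T, ‖f t‖)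
              + maxStressNorm φ σ N hN u) := by
  obtain ⟨K, -, hK⟩ := hemb.exists_norm_weakGrad_le hΩ hΩb hr
  obtain ⟨M, hM⟩ := (isCompact_closedBall (0 : Eucl d) K).exists_bound_of_continuousOn
    hφ.continuous.continuousOn
  have hM' : ∀ ζ : Eucl d, ‖ζ‖ ≤ K → φ ζ ≤ max M 0 := fun ζ hζ =>
    (le_abs_self _).trans ((hM ζ (mem_closedBall_zero_iff.mpr hζ)).trans (le_max_left _ _))
  set B := 1 + max M 0 * (volume Ω).toReal
  have hB : 0 ≤ B := by positivity
  -- The summands come from the source, the viscous term and the stress.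
  refine ⟨1 + 2 * √d * √T + B * T, by positivity, ?_⟩
  intro e μ he m N hN f hf u v h
  have hN0 : (0 : ℝ) < N := by exact_mod_cast hN
  have hF := sum_norm_timeAverage_le hT hN hf
  set τ := T / N
  have hτ : 0 < τ := div_pos hT hN0
  have hNτ : (N : ℝ) * τ = T := mul_div_cancel₀ T hN0.ne'
  set E : ℕ → ℝ := fun n => ∫ x in Ω, φ (weakGrad (u n) x)
  set S := maxStressNorm φ σ N hN u
  set Φ := ∫ t in Set.Ioo 0 T, ‖f t‖
  set Λ : ℕ → ℝ := fun n => luxemburgNorm (conjugate φ) Ω fun x => σ (weakGrad (u n) x)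
  have hΛS : ∀ n ∈ Finset.Icc 1 N, Λ n ≤ S := fun n hn => Finset.le_sup' Λ hn
  have hS : 0 ≤ S := (luxemburgNorm_nonneg _ _ _).trans
    (hΛS 1 (Finset.mem_Icc.mpr ⟨le_rfl, hN⟩))
  have hΦ : 0 ≤ Φ := integral_nonneg fun _ => norm_nonneg _
  have hE : ∀ n, 0 ≤ E n := fun n => integral_nonneg fun _ => hφ.nonneg _
  have henergy := sum_le_sq_of_energy_inequality (N := N) (a := fun n => ‖v n‖)
    (g := fun n => gradNorm (v n) ^ 2) (E := E) (F := fun n => τ * ‖timeAverage τ f n‖) hτ.le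
    (fun n => sq_nonneg _) hE (fun n => norm_nonneg _) (fun n => by positivity)
    fun n hn => h.energy_inequality hΩ hΩb hr hφ hσc hσ hτ (he.galerkinSpace_le m) hK hn
  have hsqrt : √(2 * E 0) ≤ 2 * √(E 0) := by
    rw [Real.sqrt_mul zero_le_two]
    refine mul_le_mul_of_nonneg_right ?_ (Real.sqrt_nonneg _)
    exact Real.sqrt_le_iff.mpr ⟨zero_le_two, by norm_num⟩
  set G := ∑ n ∈ Finset.Icc 1 N, gradNorm (v n)
  have hG : τ * G ≤ √T * (2 * (‖v 0‖ + √(E 0) + Φ)) := by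
    set Y := ‖v 0‖ + √(2 * E 0) + 2 * ∑ n ∈ Finset.Icc 1 N, τ * ‖timeAverage τ f n‖
    have hY0 : 0 ≤ Y := by positivity
    have hY : Y ≤ 2 * (‖v 0‖ + √(E 0) + Φ) := by
      have := norm_nonneg (v 0)
      simp only [Y]
      linarith
    refine le_trans ?_ (mul_le_mul_of_nonneg_left hY (Real.sqrt_nonneg T))
    refine le_of_sq_le_sq ?_ (by positivity)
    rw [mul_pow, mul_pow, Real.sq_sqrt hT.le]
    -- Cauchy-Schwarz over the `N` time steps; `N * τ = T` removes the dependence on `N`.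
    have hcs : G ^ 2 ≤ N * ∑ n ∈ Finset.Icc 1 N, gradNorm (v n) ^ 2 := by
      simpa using sq_sum_le_card_mul_sum_sq (s := Finset.Icc 1 N) (f := fun n => gradNorm (v n))
    calc τ ^ 2 * G ^ 2 ≤ τ ^ 2 * (N * ∑ n ∈ Finset.Icc 1 N, gradNorm (v n) ^ 2) :=
          mul_le_mul_of_nonneg_left hcs (by positivity)
      _ = T * (τ * ∑ n ∈ Finset.Icc 1 N, gradNorm (v n) ^ 2) := by rw [← hNτ]; ring
      _ ≤ T * Y ^ 2 := by
          refine mul_le_mul_of_nonneg_left ?_ hT.le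
          have : 0 ≤ τ * ∑ n ∈ Finset.Icc 1 N, gradNorm (v n) ^ 2 := by positivity
          linarith
  have hΛ : τ * ∑ n ∈ Finset.Icc 1 N, Λ n ≤ T * S := by
    calc τ * ∑ n ∈ Finset.Icc 1 N, Λ n ≤ τ * (N * S) := by
          refine mul_le_mul_of_nonneg_left ?_ hτ.le
          simpa using Finset.sum_le_card_nsmul (Finset.Icc 1 N) Λ S hΛS
      _ = T * S := by rw [← hNτ]; ring
  have hsum : τ * ∑ n ∈ Finset.Icc 1 N, dualNorm r (τ⁻¹ • (v n - v (n - 1))) ≤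
      ∑ n ∈ Finset.Icc 1 N, τ * ‖timeAverage τ f n‖ + √d * (τ * G) +
        B * (τ * ∑ n ∈ Finset.Icc 1 N, Λ n) := by
    calc _ ≤ τ * ∑ n ∈ Finset.Icc 1 N,
          (‖timeAverage τ f n‖ + √d * gradNorm (v n) + B * Λ n) := by
          refine mul_le_mul_of_nonneg_left (Finset.sum_le_sum fun n hn => ?_) hτ.le
          exact h.dualNorm_le hΩ hΩb hr hφ hσc hK (le_max_right _ _) hM' he hn
      _ = _ := by
          rw [Finset.sum_add_distrib, Finset.sum_add_distrib, ← Finset.mul_sum, ← Finset.mul_sum,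
            ← Finset.mul_sum]
          ring
  have hG' := mul_le_mul_of_nonneg_left hG (Real.sqrt_nonneg d)
  have hΛ' := mul_le_mul_of_nonneg_left hΛ hB
  have hv0 := norm_nonneg (v 0)
  have hE0 := Real.sqrt_nonneg (E 0)
  change _ ≤ (1 + 2 * √d * √T + B * T) * (‖v 0‖ + √(E 0) + Φ + S)
  clear_value E S Φ B G
  have hdT : 0 ≤ 2 * √d * √T * S := by positivity
  have hBT : 0 ≤ B * T * (‖v 0‖ + √(E 0) + Φ) := by positivity
  linarith

end Elastodynamics

theorem mainTheorem6 {d : ℕ} (hd : 1 ≤ d) (Ω : Set (Elastodynamics.Eucl d)) (hΩ : IsOpen Ω)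
    (hΩb : Bornology.IsBounded Ω) (T : ℝ) (hT : 0 < T)
    (φ : Elastodynamics.Eucl d → ℝ) (hφ : Elastodynamics.IsNFunction φ)
    (σ : Elastodynamics.Eucl d → Elastodynamics.Eucl d) (hσc : Continuous σ)
    (hσ : ∀ ξ, HasGradientAt φ (σ ξ) ξ)
    (r : ℕ) (hr : 1 ≤ r) (hemb : Elastodynamics.EmbedsInLinfty Ω (r - 1)) :
    (∃ C : ℝ, 0 < C ∧
      ∀ (e : HilbertBasis ℕ ℝ (Elastodynamics.L2 Ω)) (μ : ℕ → ℝ),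
        Elastodynamics.IsEigenbasis r e μ →
      ∀ (m N : ℕ) (hN : 1 ≤ N) (f : ℝ → Elastodynamics.L2 Ω),
        IntegrableOn f (Set.Ioo 0 T) volume →
      ∀ u v : ℕ → Elastodynamics.L2 Ω,
        Elastodynamics.IsDiscreteSolution σ (T / N) N
          (Elastodynamics.galerkinSpace e μ m) f u v →
        (T / N) * ∑ n ∈ Finset.Icc 1 N,
            Elastodynamics.dualNorm r ((T / N)⁻¹ • (v n - v (n - 1)))
          ≤ C * (‖v 0‖ + √(∫ x in Ω, φ (Elastodynamics.weakGrad (u 0) x))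
              + (∫ t in Set.Ioo 0 T, ‖f t‖)
              + Elastodynamics.maxStressNorm φ σ N hN u)) ∧
    (∀ δ : ℝ, 0 < δ → ∃ C : ℝ, 0 < C ∧
      ∀ (e : HilbertBasis ℕ ℝ (Elastodynamics.L2 Ω)) (μ : ℕ → ℝ),
        Elastodynamics.IsEigenbasis r e μ →
      ∀ (m N : ℕ) (hN : 1 ≤ N) (f : ℝ → Elastodynamics.L2 Ω),
        IntegrableOn f (Set.Ioo 0 T) volume →
      ∀ u v : ℕ → Elastodynamics.L2 Ω,
        Elastodynamics.IsDiscreteSolution σ (T / N) N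
          (Elastodynamics.galerkinSpace e μ m) f u v →
        (u 0 = 0 ∨ δ ≤ ∫ x in Ω, φ (Elastodynamics.weakGrad (u 0) x)) →
        (T / N) * ∑ n ∈ Finset.Icc 1 N,
            Elastodynamics.dualNorm r ((T / N)⁻¹ • (v n - v (n - 1)))
          ≤ C * (‖v 0‖ + (∫ x in Ω, φ (Elastodynamics.weakGrad (u 0) x))
              + (∫ t in Set.Ioo 0 T, ‖f t‖)
              + Elastodynamics.maxStressNorm φ σ N hN u)) := by
  obtain ⟨C, hC, h⟩ :=
    Elastodynamics.exists_sum_dualNorm_le hΩ hΩb hT hr hφ hσc hσ hemb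
  -- For `E ≥ δ` one has `√E ≤ E / √δ`, and `u 0 = 0` gives `E = 0`; small positive `E` would defeat
  -- any such linear bound.
  refine ⟨⟨C, hC, h⟩, fun δ hδ => ⟨C * (1 + (√δ)⁻¹), by positivity, ?_⟩⟩
  intro e μ he m N hN f hf u v hsol h0
  refine (h e μ he m N hN f hf u v hsol).trans ?_
  rw [mul_assoc]
  refine mul_le_mul_of_nonneg_left ?_ hC.le
  have hE : 0 ≤ ∫ x in Ω, φ (Elastodynamics.weakGrad (u 0) x) :=
    integral_nonneg fun _ => hφ.nonneg _
  have hS : 0 ≤ Elastodynamics.maxStressNorm φ σ N hN u :=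
    (Elastodynamics.luxemburgNorm_nonneg _ _ _).trans
      (Finset.le_sup' (fun n => Elastodynamics.luxemburgNorm (Elastodynamics.conjugate φ) Ω
        fun x => σ (Elastodynamics.weakGrad (u n) x)) (Finset.mem_Icc.mpr ⟨le_rfl, hN⟩))
  have hΦ : 0 ≤ ∫ t in Set.Ioo 0 T, ‖f t‖ := integral_nonneg fun _ => norm_nonneg _
  have hsq : √(∫ x in Ω, φ (Elastodynamics.weakGrad (u 0) x)) ≤
      (√δ)⁻¹ * ∫ x in Ω, φ (Elastodynamics.weakGrad (u 0) x) := by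
    rcases h0 with h0 | h0
    · obtain ⟨K, -, hK⟩ := hemb.exists_norm_weakGrad_le hΩ hΩb hr
      rw [h0, Elastodynamics.integral_weakGrad_zero hΩ hΩb hφ hK, Real.sqrt_zero, mul_zero]
    · rw [le_inv_mul_iff₀ (Real.sqrt_pos.mpr hδ)]
      calc _ ≤ √(∫ x in Ω, φ (Elastodynamics.weakGrad (u 0) x)) *
            √(∫ x in Ω, φ (Elastodynamics.weakGrad (u 0) x)) :=
          mul_le_mul_of_nonneg_right (Real.sqrt_le_sqrt h0) (Real.sqrt_nonneg _)
        _ = _ := Real.mul_self_sqrt hE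
  have hrest : 0 ≤ (√δ)⁻¹ * (‖v 0‖ + (∫ t in Set.Ioo 0 T, ‖f t‖) +
      Elastodynamics.maxStressNorm φ σ N hN u) := by positivity
  linarith
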